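/- Norms of matrices are spectral norms, and $\|a\|_1=\sum_j|a_j|$. **Multiproduct data.** Let $M\ge 1$, $a\in\mathbb{R}^M$ and $\vec k\in\mathbb{Z}_+^M$. For Hermitian matrices $A_1,\dots,A_L$ of the same size write $S_2(t)=e^{-iA_1t/2}\cdots e^{-iA_Lt/2}\,e^{-iA_Lt/2}\cdots e^{-iA_1t/2}$ for the second-order Trotter–Suzuki formula. Assume that $(a,\vec k)$ defines an $M$-term time-independent multiproduct formula of order $2M$: for every finite family of Hermitian matrices $A_1,\dots,A_L$ (of any finite size), $$\Big\|\sum_{j=1}^M a_j\,S_2(t/k_j)^{k_j}-e^{-i(A_1+\dots+A_L)t}\Big\|=O(t^{2M+1})\qquad(t\to0^+).$$ **Hamiltonian.** Let $n_p,q\ge 0$ be integers, and let $H$ be a function with values in the $d\times d$ complex matrices that is Hermitian and infinitely differentiable on $[0,2^q]$ (one-sided derivatives at the end points), with $H(x/2^{n_p})=H((x \bmod 2^{n_p+1})/2^{n_p})$ for all integers $0\le x<2^{n_p+q}$ and $H(1-x)=H(1+x)$ for $x\in[0,1]$. Assume that $$\Lambda=\sup_{t\in[0,2^q],\;p\ge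 0}\|\partial_t^pH(t)\|^{1/(p+1)}$$ is finite. Let $U(t,t_0)$ be the solution of $i\,\partial_tU(t,t_0)=H(t)U(t,t_0)$, $U(t_0,t_0)=1$ on $[0,2^q]$. **Time-dependent multiproduct formula.** Put $U_2(t_0+\delta,t_0)=e^{-iH(t_0+\delta/2)\delta}$ and $$U_{\vec k}(t_0+\delta,t_0)=\sum_{j=1}^Ma_j\prod_{r=1}^{k_j}U_2\big(t_0+\delta r/k_j,\;t_0+\delta (r-1)/k_j\big),$$ with later times on the left in each product. **Theorem.** For all $s\ge 0$ with $s/2^{n_p}\le 2^q$, $$\|U_{\vec k}(s/2^{n_p},0)-U(s/2^{n_p},0)\|\le C\,\|a\|_1\,(\Lambda s/2^{n_p})^{2M+1},$$ where $C>0$ is an absolute constant (independent of $M,a,\vec k,d,H,n_p,q,s$). -/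

import Mathlib

open Set Filter Topology
open scoped Matrix.Norms.L2Operator

namespace MPF

/-- Operators on `ℂ^d`. Throughout, `‖·‖` on this type is the spectral norm (the operator norm
induced by the Euclidean norm), supplied by the scope `Matrix.Norms.L2Operator`. -/
abbrev Op (d : ℕ) : Type := Matrix (Fin d) (Fin d) ℂ

/-! ### Time-independent multiproduct formulas -/

/-- The second-order (symmetric) Trotter–Suzuki formula for `A 0 + ⋯ + A (L-1)`:
`e^{-i t A_0 / 2} ⋯ e^{-i t A_{L-1} / 2} · e^{-i t A_{L-1} / 2} ⋯ e^{-i t A_0 / 2}`. -/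
noncomputable def trotter2 {d L : ℕ} (A : Fin L → Op d) (t : ℝ) : Op d :=
  (List.ofFn fun l => NormedSpace.exp ((-Complex.I * (t / 2 : ℝ)) • A l)).prod *
    (List.ofFn fun l => NormedSpace.exp ((-Complex.I * (t / 2 : ℝ)) • A l)).reverse.prod

/-- The time-independent multiproduct formula `∑ j, a_j S₂(t / k_j) ^ k_j`, where `S₂` is the
second-order Trotter–Suzuki formula. -/
noncomputable def timeIndependentMPF {M d L : ℕ} (a : Fin M → ℝ) (k : Fin M → ℕ)
    (A : Fin L → Op d) (t : ℝ) : Op d :=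
  ∑ j, (a j : ℂ) • trotter2 A (t / k j) ^ k j

/-- `(a, k)` are the data of an `M`-term time-independent multiproduct formula: the `k j` are
positive integers, and for every time-independent Hamiltonian `∑ l, A l`, split into finitely many
Hermitian terms, the error of the multiproduct formula is `O(t ^ (2 M + 1))` as `t → 0⁺`. -/
def IsMPFData {M : ℕ} (a : Fin M → ℝ) (k : Fin M → ℕ) : Prop :=
  (∀ j, 0 < k j) ∧
    ∀ (d L : ℕ) (A : Fin L → Op d), (∀ l, (A l).IsHermitian) →
      (fun t : ℝ => timeIndependentMPF a k A t
          - NormedSpace.exp ((-Complex.I * (t : ℂ)) • ∑ l, A l))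
        =O[𝓝[>] 0] fun t : ℝ => t ^ (2 * M + 1)

/-! ### Time-dependent multiproduct formulas -/

/-- The midpoint formula `U₂(t, t₀) = exp (-i H(t₀ + (t - t₀)/2) (t - t₀))`. -/
noncomputable def midpoint {d : ℕ} (H : ℝ → Op d) (t t₀ : ℝ) : Op d :=
  NormedSpace.exp ((-Complex.I * (t - t₀ : ℝ)) • H (t₀ + (t - t₀) / 2))

/-- The `k`-step midpoint formula on `[t₀, t]`, the product of the factors
`U₂(t₀ + (t - t₀)(r + 1)/k, t₀ + (t - t₀) r/k)`, `r = 0, …, k - 1`, with later times on the left. -/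
noncomputable def midpointSteps {d : ℕ} (H : ℝ → Op d) (k : ℕ) (t t₀ : ℝ) : Op d :=
  ((List.range k).map fun r : ℕ =>
    midpoint H (t₀ + (t - t₀) * ((r + 1 : ℕ) : ℝ) / k) (t₀ + (t - t₀) * (r : ℝ) / k)).reverse.prod

/-- The time-dependent multiproduct formula `U_k(t, t₀) = ∑ j, a_j U₂^{(k_j)}(t, t₀)`. -/
noncomputable def timeDependentMPF {M d : ℕ} (a : Fin M → ℝ) (k : Fin M → ℕ) (H : ℝ → Op d)
    (t t₀ : ℝ) : Op d :=
  ∑ j, (a j : ℂ) • midpointSteps H (k j) t t₀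

/-- `U` is the time evolution operator generated by `H` on the interval `I`:
`i ∂_t U(t, t₀) = H(t) U(t, t₀)` and `U(t₀, t₀) = 1` for all `t, t₀ ∈ I` (with one-sided derivatives
at the end points of `I`). -/
def IsTimeEvolution {d : ℕ} (H : ℝ → Op d) (I : Set ℝ) (U : ℝ → ℝ → Op d) : Prop :=
  ∀ t₀ ∈ I, U t₀ t₀ = 1 ∧
    ∀ t ∈ I, HasDerivWithinAt (fun τ => U τ t₀) (-Complex.I • (H t * U t t₀)) I t

/-- The quantities `‖∂_t^p H(t)‖ ^ (1 / (p + 1))`, for `t ∈ I` and `p = 0, 1, 2, …`. -/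
noncomputable def derivScales {d : ℕ} (H : ℝ → Op d) (I : Set ℝ) : Set ℝ :=
  {x | ∃ t ∈ I, ∃ p : ℕ, x = ‖iteratedDerivWithin p H I t‖ ^ (1 / ((p : ℝ) + 1))}

/-- `Λ = sup_{t ∈ I, p} ‖∂_t^p H(t)‖ ^ (1 / (p + 1))`. It is meaningful when `derivScales H I` is
bounded above. -/
noncomputable def Lam {d : ℕ} (H : ℝ → Op d) (I : Set ℝ) : ℝ := sSup (derivScales H I)

/-- The periodicity and reflection conditions imposed on the grid of `2 ^ (n + q)` clock times of
spacing `2 ^ (-n)`: `H(x / 2^n) = H((x mod 2^(n+1)) / 2^n)` at all grid points, and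
`H(1 - x) = H(1 + x)` for `x ∈ [0, 1]`. -/
def ClockPeriodic {d : ℕ} (H : ℝ → Op d) (n q : ℕ) : Prop :=
  (∀ x : ℕ, x < 2 ^ (n + q) →
    H ((x : ℝ) / 2 ^ n) = H (((x % 2 ^ (n + 1) : ℕ) : ℝ) / 2 ^ n)) ∧
  ∀ x ∈ Icc (0 : ℝ) 1, H (1 - x) = H (1 + x)

/-! ### Existence of the time evolution operator

The time evolution operator exists for every continuous Hamiltonian on a compact interval: it is the
sum of the Dyson series. -/

section Dyson

variable {A : Type*} [NormedRing A] [NormedAlgebra ℝ A]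

/-- The terms of the Dyson series of `∂_t U = G(t) U`, `U(t₀) = 1`. -/
noncomputable def dyson (G : ℝ → A) (t₀ : ℝ) : ℕ → ℝ → A
  | 0 => fun _ => 1
  | n + 1 => fun t => ∫ τ in t₀..t, G τ * dyson G t₀ n τ

theorem continuous_dyson {G : ℝ → A} (hG : Continuous G) (t₀ : ℝ) (n : ℕ) :
    Continuous (dyson G t₀ n) := by
  induction n with
  | zero => exact continuous_const
  | succ n ih =>
    exact intervalIntegral.continuous_primitive
      (fun a b => (hG.mul ih).intervalIntegrable a b) t₀

theorem hasDerivAt_dyson [CompleteSpace A] {G : ℝ → A} (hG : Continuous G) (t₀ : ℝ) (n : ℕ) (t : ℝ) :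
    HasDerivAt (dyson G t₀ (n + 1)) (G t * dyson G t₀ n t) t :=
  (hG.mul (continuous_dyson hG t₀ n)).integral_hasStrictDerivAt t₀ t |>.hasDerivAt

theorem norm_dyson_le {G : ℝ → A} {K : ℝ} (hK : 0 ≤ K) (hGK : ∀ t, ‖G t‖ ≤ K)
    (t₀ : ℝ) (n : ℕ) (t : ℝ) :
    ‖dyson G t₀ n t‖ ≤ ‖(1 : A)‖ * ((K * |t - t₀|) ^ n / n.factorial) := by
  induction n generalizing t with
  | zero => simp [dyson]
  | succ n ih =>
    have h1 : ‖dyson G t₀ (n + 1) t‖ ≤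
        |∫ τ in t₀..t, ‖(1 : A)‖ * (K ^ (n + 1) / n.factorial) * |τ - t₀| ^ n| := by
      refine intervalIntegral.norm_integral_le_abs_of_norm_le (Eventually.of_forall fun τ => ?_) ?_
      · calc ‖G τ * dyson G t₀ n τ‖ ≤ ‖G τ‖ * ‖dyson G t₀ n τ‖ := norm_mul_le _ _
          _ ≤ K * (‖(1 : A)‖ * ((K * |τ - t₀|) ^ n / n.factorial)) :=
              mul_le_mul (hGK τ) (ih τ) (norm_nonneg _) hK
          _ = _ := by rw [mul_pow]; ring
      · exact Continuous.intervalIntegrable (by fun_prop) _ _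
    refine h1.trans (le_of_eq ?_)
    rw [intervalIntegral.integral_const_mul, abs_mul, intervalIntegral.abs_intervalIntegral_eq,
      integral_pow_abs_sub_uIoc, abs_of_nonneg (by positivity),
      abs_of_nonneg (by positivity), Nat.factorial_succ, mul_pow]
    push_cast
    field_simp

theorem hasDerivAt_tsum_dyson [CompleteSpace A] {G : ℝ → A} (hG : Continuous G) {K : ℝ} (hGK : ∀ t, ‖G t‖ ≤ K)
    (t₀ t : ℝ) :
    HasDerivAt (fun τ => ∑' n, dyson G t₀ n τ) (G t * ∑' n, dyson G t₀ n t) t := by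
  have hK : 0 ≤ K := (norm_nonneg _).trans (hGK 0)
  have hsum : ∀ s, Summable fun n => dyson G t₀ n s := fun s =>
    Summable.of_norm_bounded ((Real.summable_pow_div_factorial (K * |s - t₀|)).mul_left ‖(1 : A)‖)
      fun n => norm_dyson_le hK hGK t₀ n s
  set R : ℝ := |t - t₀| + 1 with hR
  have hR0 : 0 ≤ R := by positivity
  have hmem : ∀ s, s ∈ Metric.ball t₀ R ↔ |s - t₀| < R := fun s => by
    rw [Metric.mem_ball, Real.dist_eq]
  have key : HasDerivAt (fun τ => ∑' n, dyson G t₀ (n + 1) τ)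
      (∑' n, G t * dyson G t₀ n t) t := by
    refine hasDerivAt_tsum_of_isPreconnected (𝕜 := ℝ) (F := A)
      (g := fun n => dyson G t₀ (n + 1)) (g' := fun n y => G y * dyson G t₀ n y)
      (u := fun n => K * (‖(1 : A)‖ * ((K * R) ^ n / n.factorial)))
      (((Real.summable_pow_div_factorial (K * R)).mul_left ‖(1 : A)‖).mul_left K)
      (t := Metric.ball t₀ R) Metric.isOpen_ball (convex_ball t₀ R).isPreconnected
      (fun n y _ => hasDerivAt_dyson hG t₀ n y) (fun n y hy => ?_)
      (y₀ := t) ((hmem t).2 (by rw [hR]; linarith)) ((summable_nat_add_iff 1).2 (hsum t))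
      ((hmem t).2 (by rw [hR]; linarith))
    refine (norm_mul_le _ _).trans (mul_le_mul (hGK y) ((norm_dyson_le hK hGK t₀ n y).trans ?_)
      (norm_nonneg _) hK)
    have := ((hmem y).1 hy).le
    gcongr
  rw [(hsum t).tsum_mul_left] at key
  have hfun : (fun τ => ∑' n, dyson G t₀ n τ) = fun τ => 1 + ∑' n, dyson G t₀ (n + 1) τ := by
    funext τ
    exact (hsum τ).tsum_eq_zero_add
  rw [hfun]
  exact key.const_add 1

theorem tsum_dyson_self (G : ℝ → A) (t₀ : ℝ) : ∑' n, dyson G t₀ n t₀ = 1 := by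
  rw [tsum_eq_single 0]
  · rfl
  · intro n hn
    obtain ⟨m, rfl⟩ := Nat.exists_eq_succ_of_ne_zero hn
    simp [dyson]

end Dyson

theorem exists_isTimeEvolution {d : ℕ} (H : ℝ → Op d) {a b : ℝ} (hab : a ≤ b)
    (hH : ContinuousOn H (Icc a b)) : ∃ U, IsTimeEvolution H (Icc a b) U := by
  set G : ℝ → Op d := fun t => -Complex.I • IccExtend hab ((Icc a b).domRestrict H) t with hGdef
  have hE : Continuous (IccExtend hab ((Icc a b).domRestrict H)) :=
    hH.domRestrict.Icc_extend'
  have hG : Continuous G := hE.const_smul (-Complex.I)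
  obtain ⟨K, hK⟩ := (isCompact_Icc (a := a) (b := b)).exists_bound_of_continuousOn hH
  have hGK : ∀ t, ‖G t‖ ≤ K := fun t => by
    have := hK _ (projIcc a b hab t).2
    simpa [hGdef, norm_smul, IccExtend] using this
  refine ⟨fun t t₀ => ∑' n, dyson G t₀ n t, fun t₀ _ => ⟨tsum_dyson_self G t₀, fun t ht => ?_⟩⟩
  have h := (hasDerivAt_tsum_dyson hG hGK t₀ t).hasDerivWithinAt (s := Icc a b)
  have hGt : G t = -Complex.I • H t := by
    simp [hGdef, IccExtend_of_mem hab _ ht]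
  rw [hGt, smul_mul_assoc] at h
  exact h

end MPF

namespace MPF

/-! ### Formal exponentials -/

section Formal

open PowerSeries Finset

variable {R : Type*} [Ring R]

/-! The order conditions are carried from time-independent splittings to the time-dependent midpoint
formula by treating the derivative as an operator. Let D be differentiation and G multiplication by
the generator -iH, both acting on sequences of derivatives at 0. By Taylor's theorem e^{cD} G
e^{-cD} is multiplication by the translate G(c + ·). So each midpoint exponential is a conjugate of
e^{tG/k} by a power of e^{tD}. The conjugations telescope, and the k-step midpoint formula becomes
e^{tD} times the k-th power of the Strang splitting of t(-D + G) (`intertwines_midpointSeries`). The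
exact evolution likewise becomes e^{tD} e^{t(-D + G)} (`intertwines_evolution`). Thus the Taylor
coefficients of the error vanish through degree 2M once the order conditions hold for the pair (-D,
G) (`coeff_sum_midpointSeries`).

That pair is neither Hermitian nor finite-dimensional, so the conditions are first made universal.
In the free algebra the degree-n coefficient is a combination of words of length n in two letters,
and labelled path graphs give Hermitian matrices isolating any single word
(`coeff_mpfSeries_eq_zero`).

The rest is majorant analysis. If all p-th derivatives are at most L^{p+1}, then H equals its Taylor
series. At radius 1/L the midpoint series has weighted ℓ¹ norm at most e^e, independently of k, and
the evolution series at most 2^16. Vanishing of the first 2M + 1 coefficients then gains the factor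
(Lx)^{2M+1} when Lx ≤ 1. When Lx > 1, unitarity and ‖a‖₁ ≥ |∑ a_j| = 1 suffice. Finally L decreases
to Λ. -/

theorem X_mul_pow (F : R⟦X⟧) (n : ℕ) : (X * F) ^ n = X ^ n * F ^ n :=
  (commute_X F).symm.mul_pow n

theorem coeff_X_mul_pow_of_lt (F : R⟦X⟧) {m n : ℕ} (h : m < n) : coeff m ((X * F) ^ n) = 0 := by
  rw [X_mul_pow, (commute_X (F ^ n)).symm.pow_left n |>.eq]
  rw [coeff_mul_X_pow', if_neg (by omega)]

theorem coeff_mul_congr {P P' Q Q' : R⟦X⟧} {m : ℕ} (h : ∀ i ≤ m, coeff i P = coeff i P')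
    (h' : ∀ i ≤ m, coeff i Q = coeff i Q') : coeff m (P * Q) = coeff m (P' * Q') := by
  rw [coeff_mul, coeff_mul]
  refine sum_congr rfl fun ij hij => ?_
  rw [HasAntidiagonal.mem_antidiagonal] at hij
  rw [h _ (by omega), h' _ (by omega)]

variable [Algebra ℂ R]

/-- The formal power series `e^{t x}` in `t`. -/
noncomputable def fe (x : R) : R⟦X⟧ := mk fun n => ((n.factorial : ℂ)⁻¹) • x ^ n

/-- The formal power series `exp (t F(t))` in `t`. -/
noncomputable def fexp (F : R⟦X⟧) : R⟦X⟧ :=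
  mk fun m => ∑ n ∈ range (m + 1), ((n.factorial : ℂ)⁻¹) • coeff m ((X * F) ^ n)

theorem coeff_const_smul (c : ℂ) (P : R⟦X⟧) (n : ℕ) : coeff n (c • P) = c • coeff n P := rfl

theorem coeff_fe (x : R) (n : ℕ) : coeff n (fe x) = ((n.factorial : ℂ)⁻¹) • x ^ n := coeff_mk _ _

theorem fe_zero : fe (0 : R) = 1 := by
  ext n
  rw [coeff_fe, coeff_one]
  rcases eq_or_ne n 0 with rfl | h <;> simp [*]

theorem fe_mul_fe {x y : R} (h : Commute x y) : fe x * fe y = fe (x + y) := by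
  ext n
  rw [coeff_mul, coeff_fe, h.add_pow', smul_sum]
  refine sum_congr rfl fun ij hij => ?_
  rw [HasAntidiagonal.mem_antidiagonal] at hij
  rw [coeff_fe, coeff_fe, smul_mul_smul_comm, ← Nat.cast_smul_eq_nsmul ℂ, smul_smul]
  congr 1
  subst hij
  have hc : ((ij.1 + ij.2).choose ij.1 : ℂ) * ij.1.factorial * ij.2.factorial
      = (ij.1 + ij.2).factorial :=
    mod_cast by simpa using Nat.choose_mul_factorial_mul_factorial (Nat.le_add_right ij.1 ij.2)
  have h₁ : (ij.1.factorial : ℂ) ≠ 0 := mod_cast ij.1.factorial_ne_zero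
  have h₂ : (ij.2.factorial : ℂ) ≠ 0 := mod_cast ij.2.factorial_ne_zero
  have h₃ : ((ij.1 + ij.2).factorial : ℂ) ≠ 0 := mod_cast (ij.1 + ij.2).factorial_ne_zero
  field_simp
  linear_combination -hc

theorem fe_smul_mul_fe_smul (c c' : ℂ) (x : R) : fe (c • x) * fe (c' • x) = fe ((c + c') • x) := by
  rw [fe_mul_fe (((Commute.refl x).smul_left c).smul_right c'), add_smul]

theorem fe_neg_smul_mul_fe_smul (c c' : ℂ) (x : R) :
    fe (-(c • x)) * fe (c' • x) = fe ((-c + c') • x) := by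
  rw [← neg_smul, fe_smul_mul_fe_smul]

theorem fe_mul_fe_neg (x : R) : fe x * fe (-x) = 1 := by
  rw [fe_mul_fe (Commute.refl x).neg_right, add_neg_cancel, fe_zero]

theorem fe_neg_mul_fe (x : R) : fe (-x) * fe x = 1 := by
  rw [fe_mul_fe (Commute.refl x).neg_left, neg_add_cancel, fe_zero]

theorem map_fe {S : Type*} [Ring S] [Algebra ℂ S] (f : R →ₐ[ℂ] S) (x : R) :
    PowerSeries.map (f : R →+* S) (fe x) = fe (f x) := by
  ext n
  rw [coeff_map, coeff_fe, coeff_fe]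
  simp

theorem coeff_fexp (F : R⟦X⟧) {m N : ℕ} (h : m < N) :
    coeff m (fexp F) = coeff m (∑ n ∈ range N, ((n.factorial : ℂ)⁻¹) • (X * F) ^ n) := by
  rw [fexp, coeff_mk, map_sum]
  refine sum_subset (range_mono h) (fun n _ hn => ?_) |>.trans (sum_congr rfl fun n _ => by simp)
  rw [coeff_X_mul_pow_of_lt F (by simpa using hn), smul_zero]

/-- Conjugation by an invertible series passes through every power, since t is central. Each
coefficient of the exponential sees only finitely many powers, so finite sums suffice. -/
theorem fexp_conj {u v : R⟦X⟧} (h : v * u = 1) (h' : u * v = 1) (F : R⟦X⟧) :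
    fexp (u * F * v) = u * fexp F * v := by
  ext m
  rw [coeff_mul_congr (P := u * fexp F) (Q := v)
    (P' := u * ∑ n ∈ range (m + 1), ((n.factorial : ℂ)⁻¹) • (X * F) ^ n) (Q' := v)
    (fun i hi => coeff_mul_congr (fun _ _ => rfl) fun j hj => coeff_fexp F (by omega))
    (fun _ _ => rfl), coeff_fexp _ (Nat.lt_succ_self m), mul_sum, sum_mul]
  congr 1
  refine sum_congr rfl fun n _ => ?_
  clear * - h h'
  rw [mul_smul_comm, smul_mul_assoc]
  congr 1
  have hX : X * (u * F * v) = u * (X * F) * v := by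
    rw [← mul_assoc, ← mul_assoc, ← mul_assoc, (commute_X u).eq]
  rw [hX]
  induction n with
  | zero => simp [h']
  | succ n ih =>
    rw [pow_succ, ih, pow_succ]
    calc u * (X * F) ^ n * v * (u * (X * F) * v) = u * (X * F) ^ n * (v * u) * (X * F) * v := by
          noncomm_ring
      _ = _ := by rw [h]; noncomm_ring

theorem fexp_C (x : R) : fexp (C x) = fe x := by
  ext m
  rw [fexp, coeff_mk, coeff_fe]
  rw [sum_eq_single m]
  · rw [X_mul_pow, ← map_pow, (commute_X _).symm.pow_left m |>.eq, coeff_C_mul_X_pow]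
    simp
  · intro n _ hn
    rw [X_mul_pow, ← map_pow, (commute_X _).symm.pow_left n |>.eq, coeff_C_mul_X_pow,
      if_neg hn.symm, smul_zero]
  · simp

/-- The formal power series in `t` of the error of the multiproduct formula built from the Strang
splitting `e^{t x / 2} e^{t y} e^{t x / 2}` of `e^{t (x + y)}`. -/
noncomputable def mpfSeries {M : ℕ} (a : Fin M → ℝ) (k : Fin M → ℕ) (x y : R) : R⟦X⟧ :=
  ∑ j, (a j : ℂ) • (fe ((1 / (2 * k j) : ℂ) • x) * fe ((1 / k j : ℂ) • y)
    * fe ((1 / (2 * k j) : ℂ) • x)) ^ k j - fe (x + y)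

theorem map_mpfSeries {S : Type*} [Ring S] [Algebra ℂ S] (f : R →ₐ[ℂ] S) {M : ℕ} (a : Fin M → ℝ)
    (k : Fin M → ℕ) (x y : R) :
    PowerSeries.map (f : R →+* S) (mpfSeries a k x y) = mpfSeries a k (f x) (f y) := by
  have hs : ∀ (c : ℂ) (P : R⟦X⟧),
      PowerSeries.map (f : R →+* S) (c • P) = c • PowerSeries.map (f : R →+* S) P := by
    intro c P
    ext n
    simp
  simp only [mpfSeries, map_sub, map_sum, hs, map_pow, map_mul, map_fe, map_smul, map_add]

/-- Homogeneity: series whose n-th coefficient has degree n in the letters are closed under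
products. Hence only words of length exactly n have to be separated later. -/
theorem coeff_mpfSeries_mem {M : ℕ} (a : Fin M → ℝ) (k : Fin M → ℕ) (x y : R) (n : ℕ) :
    coeff n (mpfSeries a k x y) ∈ (Submodule.span ℂ {x, y}) ^ n := by
  set V := Submodule.span ℂ ({x, y} : Set R)
  have hx : x ∈ V := Submodule.subset_span (by simp)
  have hy : y ∈ V := Submodule.subset_span (by simp)
  have hfe : ∀ z ∈ V, ∀ n, coeff n (fe z) ∈ V ^ n := fun z hz n => by
    rw [coeff_fe]
    exact Submodule.smul_mem _ _ (Submodule.pow_mem_pow V hz n)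
  have hmul : ∀ P Q : R⟦X⟧, (∀ n, coeff n P ∈ V ^ n) → (∀ n, coeff n Q ∈ V ^ n) →
      ∀ n, coeff n (P * Q) ∈ V ^ n := fun P Q hP hQ n => by
    rw [coeff_mul]
    refine Submodule.sum_mem _ fun ij hij => ?_
    rw [← HasAntidiagonal.mem_antidiagonal.1 hij, pow_add]
    exact Submodule.mul_mem_mul (hP _) (hQ _)
  have hpow : ∀ P : R⟦X⟧, (∀ n, coeff n P ∈ V ^ n) → ∀ r n, coeff n (P ^ r) ∈ V ^ n := by
    intro P hP r
    induction r with
    | zero =>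
      rw [pow_zero, ← fe_zero]
      exact hfe 0 V.zero_mem
    | succ r ih => rw [pow_succ]; exact hmul _ _ ih hP
  rw [mpfSeries, map_sub, map_sum]
  refine Submodule.sub_mem _ (Submodule.sum_mem _ fun j _ => ?_) (hfe _ (V.add_mem hx hy) n)
  rw [coeff_const_smul]
  exact Submodule.smul_mem _ _ (hpow _ (hmul _ _ (hmul _ _ (hfe _ (V.smul_mem _ hx))
    (hfe _ (V.smul_mem _ hy))) (hfe _ (V.smul_mem _ hx))) _ _)

end Formal

/-! ### Transfer from operators to time-dependent generators -/

section Transfer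

open PowerSeries Finset

variable {𝔸 : Type*} [Ring 𝔸] [Algebra ℂ 𝔸]

/-- The derivative, on functions represented by their sequence of derivatives at `0`. -/
def derivOp : Module.End ℂ (ℕ → 𝔸) := LinearMap.funLeft ℂ 𝔸 Nat.succ

/-- Left multiplication by the function with derivatives `g` at `0`, on functions represented by
their sequence of derivatives at `0`. -/
def mulOp (g : ℕ → 𝔸) : Module.End ℂ (ℕ → 𝔸) where
  toFun f p := ∑ ij ∈ antidiagonal p, p.choose ij.1 • (g ij.1 * f ij.2)
  map_add' f f' := by
    funext p
    simp [mul_add, sum_add_distrib]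
  map_smul' c f := by
    funext p
    simp [smul_sum]

theorem mulOp_apply_zero (g f : ℕ → 𝔸) : mulOp g f 0 = g 0 * f 0 := by simp [mulOp]

/-- The Leibniz rule as a commutator, [D, G] = G'. -/
theorem derivOp_mul_mulOp (g : ℕ → 𝔸) :
    derivOp * mulOp g = mulOp g * derivOp + mulOp (fun p => g (p + 1)) := by
  ext f p
  change ∑ ij ∈ antidiagonal (p + 1), (p + 1).choose ij.1 • (g ij.1 * f ij.2) =
    ∑ ij ∈ antidiagonal p, p.choose ij.1 • (g ij.1 * f (ij.2 + 1)) +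
      ∑ ij ∈ antidiagonal p, p.choose ij.1 • (g (ij.1 + 1) * f ij.2)
  rw [sum_antidiagonal_choose_succ_nsmul (fun i j => g i * f j)]
  congr 1
  refine sum_congr rfl fun ij hij => ?_
  rw [Nat.choose_symm_of_eq_add (HasAntidiagonal.mem_antidiagonal.1 hij).symm]

theorem derivOp_pow_mul_mulOp (g : ℕ → 𝔸) (n : ℕ) :
    derivOp ^ n * mulOp g =
      ∑ ij ∈ antidiagonal n, n.choose ij.1 • (mulOp (fun p => g (p + ij.1)) * derivOp ^ ij.2) := by
  induction n with
  | zero => simp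
  | succ n ih =>
    rw [sum_antidiagonal_choose_succ_nsmul
      (fun i j => mulOp (fun p => g (p + i)) * derivOp ^ j) n, pow_succ', mul_assoc, ih, mul_sum,
      ← sum_add_distrib]
    refine sum_congr rfl fun ij hij => ?_
    rw [← Nat.choose_symm_of_eq_add (HasAntidiagonal.mem_antidiagonal.1 hij).symm, mul_smul_comm,
      ← mul_assoc, derivOp_mul_mulOp, add_mul, smul_add, mul_assoc, ← pow_succ']
    simp only [add_assoc, add_comm 1]

/-- The Taylor series of `t ↦ G(c t)`, where `G` has the derivatives `g` at `0`. -/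
noncomputable def taylorSeries {E : Type*} [Ring E] [Algebra ℂ E] (g : ℕ → E) (c : ℂ) : E⟦X⟧ :=
  mk fun p => (c ^ p / p.factorial) • g p

/-- Taylor's theorem in operator form: e^{ctD} translates by ct, so moving it past G replaces G by
its translate. Coefficientwise this is the iterated Leibniz rule. -/
theorem fe_derivOp_mul_C_mulOp (g : ℕ → 𝔸) (c : ℂ) :
    fe (c • derivOp) * C (mulOp g) =
      taylorSeries (fun i => mulOp fun p => g (p + i)) c * fe (c • derivOp) := by
  ext n : 1
  rw [coeff_mul_C, coeff_fe, coeff_mul, smul_pow, smul_mul_assoc, smul_mul_assoc,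
    derivOp_pow_mul_mulOp, smul_smul, smul_sum]
  refine sum_congr rfl fun ij hij => ?_
  rw [HasAntidiagonal.mem_antidiagonal] at hij
  rw [taylorSeries, coeff_mk, coeff_fe, smul_pow, smul_smul, smul_mul_smul_comm,
    ← Nat.cast_smul_eq_nsmul ℂ, smul_smul]
  congr 1
  subst hij
  have hc : ((ij.1 + ij.2).choose ij.1 : ℂ) * ij.1.factorial * ij.2.factorial
      = (ij.1 + ij.2).factorial :=
    mod_cast by simpa using Nat.choose_mul_factorial_mul_factorial (Nat.le_add_right ij.1 ij.2)
  have h₁ : (ij.1.factorial : ℂ) ≠ 0 := mod_cast ij.1.factorial_ne_zero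
  have h₂ : (ij.2.factorial : ℂ) ≠ 0 := mod_cast ij.2.factorial_ne_zero
  have h₃ : ((ij.1 + ij.2).factorial : ℂ) ≠ 0 := mod_cast (ij.1 + ij.2).factorial_ne_zero
  rw [pow_add]
  field_simp
  linear_combination (c ^ ij.1 * c ^ ij.2) * hc

theorem fe_mul_C_mul_fe (g : ℕ → 𝔸) (c : ℂ) :
    fe (c • derivOp) * C (mulOp g) * fe (-(c • derivOp)) =
      taylorSeries (fun i => mulOp fun p => g (p + i)) c := by
  rw [fe_derivOp_mul_C_mulOp, mul_assoc, fe_mul_fe_neg, mul_one]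

/-- Evaluation at `0` carries the operator-valued series `P` to left multiplication by `Q`. -/
def Intertwines (P : (Module.End ℂ (ℕ → 𝔸))⟦X⟧) (Q : 𝔸⟦X⟧) : Prop :=
  ∀ n f, coeff n P f 0 = coeff n Q * f 0

theorem Intertwines.mul {P P' : (Module.End ℂ (ℕ → 𝔸))⟦X⟧} {Q Q' : 𝔸⟦X⟧}
    (h : Intertwines P Q) (h' : Intertwines P' Q') : Intertwines (P * P') (Q * Q') := by
  intro n f
  rw [coeff_mul, coeff_mul, LinearMap.sum_apply, Finset.sum_apply, sum_mul]
  refine sum_congr rfl fun ij _ => ?_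
  rw [Module.End.mul_apply, h, h', mul_assoc]

theorem Intertwines.one : Intertwines (1 : (Module.End ℂ (ℕ → 𝔸))⟦X⟧) 1 := by
  intro n f
  rw [coeff_one, coeff_one]
  split_ifs <;> simp

theorem Intertwines.X : Intertwines (X : (Module.End ℂ (ℕ → 𝔸))⟦X⟧) X := by
  intro n f
  rw [coeff_X, coeff_X]
  split_ifs <;> simp

theorem Intertwines.smul {P : (Module.End ℂ (ℕ → 𝔸))⟦X⟧} {Q : 𝔸⟦X⟧}
    (h : Intertwines P Q) (c : ℂ) : Intertwines (c • P) (c • Q) := by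
  intro n f
  rw [coeff_const_smul, coeff_const_smul, LinearMap.smul_apply, Pi.smul_apply, h, smul_mul_assoc]

theorem Intertwines.sum {ι : Type*} {s : Finset ι} {P : ι → (Module.End ℂ (ℕ → 𝔸))⟦X⟧}
    {Q : ι → 𝔸⟦X⟧} (h : ∀ i ∈ s, Intertwines (P i) (Q i)) :
    Intertwines (∑ i ∈ s, P i) (∑ i ∈ s, Q i) := by
  intro n f
  rw [map_sum, map_sum, LinearMap.sum_apply, Finset.sum_apply, sum_mul]
  exact sum_congr rfl fun i hi => h i hi n f

theorem Intertwines.pow {P : (Module.End ℂ (ℕ → 𝔸))⟦X⟧} {Q : 𝔸⟦X⟧}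
    (h : Intertwines P Q) (r : ℕ) : Intertwines (P ^ r) (Q ^ r) := by
  induction r with
  | zero => simpa using Intertwines.one
  | succ r ih => rw [pow_succ, pow_succ]; exact ih.mul h

theorem Intertwines.fexp {P : (Module.End ℂ (ℕ → 𝔸))⟦X⟧} {Q : 𝔸⟦X⟧}
    (h : Intertwines P Q) : Intertwines (fexp P) (fexp Q) := by
  intro n f
  rw [coeff_fexp P n.lt_succ_self, coeff_fexp Q n.lt_succ_self]
  exact Intertwines.sum (fun i _ => ((Intertwines.X.mul h).pow i).smul _) n f

theorem Intertwines.list_prod {P : ℕ → (Module.End ℂ (ℕ → 𝔸))⟦X⟧} {Q : ℕ → 𝔸⟦X⟧}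
    (h : ∀ r, Intertwines (P r) (Q r)) (m : ℕ) :
    Intertwines ((List.range m).map P).reverse.prod ((List.range m).map Q).reverse.prod := by
  induction m with
  | zero => simpa using Intertwines.one
  | succ m ih => simpa [List.range_succ] using (h m).mul ih

theorem intertwines_taylorSeries (g : ℕ → 𝔸) (c : ℂ) :
    Intertwines (taylorSeries (fun i => mulOp fun p => g (p + i)) c) (taylorSeries g c) := by
  intro n f
  rw [taylorSeries, taylorSeries, coeff_mk, coeff_mk, LinearMap.smul_apply, Pi.smul_apply,
    mulOp_apply_zero, zero_add, smul_mul_assoc]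

/-- The Taylor series of the `k`-step midpoint formula on `[0, t]`. -/
noncomputable def midpointSeries {E : Type*} [Ring E] [Algebra ℂ E] (g : ℕ → E) (k : ℕ) : E⟦X⟧ :=
  ((List.range k).map fun r : ℕ =>
    fexp ((1 / k : ℂ) • taylorSeries g ((r + 1 / 2) / k))).reverse.prod

/-- The shifts telescope. Between neighbouring midpoints the outer translations merge, leaving half
a step of -D on either side of each e^{tB/k}, which is the Strang form. -/
theorem prod_fe_derivOp (B : Module.End ℂ (ℕ → 𝔸)) (k m : ℕ) (hk : k ≠ 0) :
    ((List.range m).map fun r : ℕ => fe (((r + 1 / 2) / k : ℂ) • derivOp) *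
      fe ((1 / k : ℂ) • B) * fe (-(((r + 1 / 2) / k : ℂ) • derivOp))).reverse.prod =
    fe ((m / k : ℂ) • derivOp) * (fe ((1 / (2 * k) : ℂ) • -derivOp) * fe ((1 / k : ℂ) • B) *
      fe ((1 / (2 * k) : ℂ) • -derivOp)) ^ m := by
  have hk' : (k : ℂ) ≠ 0 := mod_cast hk
  induction m with
  | zero => simp [fe_zero]
  | succ m ih =>
    have h₁ : fe (((m + 1 / 2) / k : ℂ) • (derivOp : Module.End ℂ (ℕ → 𝔸))) =
        fe (((m + 1 : ℕ) / k : ℂ) • derivOp) * fe ((1 / (2 * k) : ℂ) • -derivOp) := by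
      rw [smul_neg, ← neg_smul, fe_smul_mul_fe_smul]
      congr 2
      push_cast
      field_simp
      ring
    have h₂ : fe (-(((m + 1 / 2) / k : ℂ) • (derivOp : Module.End ℂ (ℕ → 𝔸)))) *
        fe ((m / k : ℂ) • derivOp) = fe ((1 / (2 * k) : ℂ) • -derivOp) := by
      rw [fe_neg_smul_mul_fe_smul, smul_neg, ← neg_smul]
      congr 2
      field_simp
      ring
    rw [List.range_succ, List.map_append, List.reverse_append, List.prod_append, ih,
      List.map_singleton, List.reverse_singleton, List.prod_singleton, mul_assoc,
      ← mul_assoc (fe (-_)), h₂, h₁, pow_succ']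
    noncomm_ring

theorem intertwines_midpointSeries (g : ℕ → 𝔸) (k : ℕ) (hk : k ≠ 0) :
    Intertwines (fe derivOp * (fe ((1 / (2 * k) : ℂ) • -derivOp) * fe ((1 / k : ℂ) • mulOp g) *
      fe ((1 / (2 * k) : ℂ) • -derivOp)) ^ k) (midpointSeries g k) := by
  have hk' : (k : ℂ) ≠ 0 := mod_cast hk
  have h := prod_fe_derivOp (mulOp g) k k hk
  rw [div_self hk', one_smul] at h
  rw [← h]
  refine Intertwines.list_prod (fun r => ?_) k
  have h' : fe (((r + 1 / 2) / k : ℂ) • derivOp) * fe ((1 / k : ℂ) • mulOp g) *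
      fe (-(((r + 1 / 2) / k : ℂ) • derivOp)) =
      fexp ((1 / k : ℂ) • taylorSeries (fun i => mulOp fun p => g (p + i)) ((r + 1 / 2) / k)) := by
    rw [← fe_mul_C_mul_fe, ← fexp_C ((1 / k : ℂ) • mulOp g), ← fexp_conj (fe_neg_mul_fe _) (fe_mul_fe_neg _)]
    congr 1
    have : C ((1 / k : ℂ) • mulOp g) = (1 / k : ℂ) • C (mulOp g) := by
      ext n : 1
      rw [coeff_const_smul, coeff_C, coeff_C]
      split_ifs <;> simp
    rw [this, mul_smul_comm, smul_mul_assoc]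
  rw [h']
  exact ((intertwines_taylorSeries g _).smul _).fexp

/-- The Taylor coefficients at `0` of the solution of `u' = G u`, `u(0) = 1`, where `G` has the
derivatives `g` at `0`. -/
noncomputable def evolutionCoeff (g : ℕ → 𝔸) : ℕ → 𝔸
  | 0 => 1
  | n + 1 => (1 / (n + 1) : ℂ) • ∑ i : Fin (n + 1),
      ((n - i : ℕ).factorial : ℂ)⁻¹ • (g (n - i) * evolutionCoeff g i)

theorem evolutionCoeff_succ (g : ℕ → 𝔸) (n : ℕ) :
    ((n : ℂ) + 1) • evolutionCoeff g (n + 1) =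
      coeff n (taylorSeries g 1 * mk (evolutionCoeff g)) := by
  rw [evolutionCoeff, smul_smul, mul_one_div_cancel (Nat.cast_add_one_ne_zero n), one_smul,
    coeff_mul, ← Finset.sum_range (fun i => ((n - i : ℕ).factorial : ℂ)⁻¹ •
      (g (n - i) * evolutionCoeff g i)), ← Nat.sum_antidiagonal_swap,
    Nat.sum_antidiagonal_eq_sum_range_succ_mk]
  simp [taylorSeries]

/-- The product rule (e^{tx} e^{ty})' = e^{tx} (x + y) e^{ty}, read off coefficientwise. -/
theorem coeff_succ_fe_mul_fe {R : Type*} [Ring R] [Algebra ℂ R] (x y : R) (n : ℕ) :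
    ((n : ℂ) + 1) • coeff (n + 1) (fe x * fe y) = coeff n (fe x * C (x + y) * fe y) := by
  have hd : ∀ (z : R) (m : ℕ), (((m + 1 : ℕ) : ℂ)) • coeff (m + 1) (fe z) = z * coeff m (fe z) := by
    intro z m
    rw [coeff_fe, coeff_fe, smul_smul, mul_smul_comm, ← pow_succ']
    congr 1
    rw [Nat.factorial_succ]
    have h₁ : (m.factorial : ℂ) ≠ 0 := mod_cast m.factorial_ne_zero
    have h₂ : ((m + 1 : ℕ) : ℂ) ≠ 0 := mod_cast m.succ_ne_zero
    push_cast at h₂ ⊢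
    field_simp
  have hcomm : ∀ (z : R) (m : ℕ), Commute z (coeff m (fe z)) := by
    intro z m
    rw [coeff_fe]
    exact ((Commute.refl z).pow_right m).smul_right _
  have hsplit : ((n : ℂ) + 1) • coeff (n + 1) (fe x * fe y) =
      ∑ ij ∈ antidiagonal (n + 1), (((ij.1 : ℂ) • coeff ij.1 (fe x)) * coeff ij.2 (fe y)) +
      ∑ ij ∈ antidiagonal (n + 1), (coeff ij.1 (fe x) * ((ij.2 : ℂ) • coeff ij.2 (fe y))) := by
    rw [coeff_mul, smul_sum, ← sum_add_distrib]
    refine sum_congr rfl fun ij hij => ?_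
    rw [smul_mul_assoc, mul_smul_comm, ← add_smul]
    congr 1
    exact_mod_cast (HasAntidiagonal.mem_antidiagonal.1 hij).symm
  rw [hsplit, Nat.sum_antidiagonal_succ, Nat.sum_antidiagonal_succ', map_add, mul_add, add_mul,
    map_add, coeff_mul, coeff_mul]
  simp only [hd, coeff_mul_C]
  simp only [Nat.cast_zero, zero_smul, zero_mul, mul_zero, zero_add]
  congr 1
  · exact sum_congr rfl fun ij _ => by rw [(hcomm x _).eq]
  · exact sum_congr rfl fun ij _ => by rw [mul_assoc]

/-- W = e^{tD} e^{t(-D + G)} satisfies W' = e^{tD} G e^{t(-D + G)} = G(t) W, because D cancels in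
the product rule. After evaluation at 0 this is the recursion for the evolution coefficients. -/
theorem intertwines_evolution (g : ℕ → 𝔸) :
    Intertwines (fe derivOp * fe (-derivOp + mulOp g)) (mk (evolutionCoeff g)) := by
  have hW : fe derivOp * C (derivOp + (-derivOp + mulOp g)) * fe (-derivOp + mulOp g) =
      taylorSeries (fun i => mulOp fun p => g (p + i)) 1 *
        (fe derivOp * fe (-derivOp + mulOp g)) := by
    have h := fe_derivOp_mul_C_mulOp g 1
    rw [one_smul] at h
    rw [add_neg_cancel_left, h, mul_assoc]
  intro n
  induction n using Nat.strong_induction_on with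
  | _ n ih =>
    intro f
    cases n with
    | zero => simp [coeff_mul, coeff_fe, evolutionCoeff]
    | succ n =>
      have hn : ((n : ℂ) + 1) ≠ 0 := Nat.cast_add_one_ne_zero n
      refine (smul_right_injective 𝔸 hn) ?_
      change ((n : ℂ) + 1) • _ = ((n : ℂ) + 1) • _
      rw [← smul_mul_assoc, coeff_mk, evolutionCoeff_succ, ← Pi.smul_apply, ← LinearMap.smul_apply,
        coeff_succ_fe_mul_fe, hW, coeff_mul, coeff_mul, LinearMap.sum_apply, Finset.sum_apply,
        sum_mul]
      refine sum_congr rfl fun ij hij => ?_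
      rw [HasAntidiagonal.mem_antidiagonal] at hij
      rw [Module.End.mul_apply, intertwines_taylorSeries g 1, ih _ (by omega), mul_assoc]

/-- The order conditions for the Strang splitting are also those for the midpoint formula of a
time-dependent generator. -/
theorem coeff_sum_midpointSeries {M : ℕ} {a : Fin M → ℝ} {k : Fin M → ℕ} (hk : ∀ j, k j ≠ 0)
    (g : ℕ → 𝔸) {n : ℕ}
    (h : ∀ m ≤ n, coeff m (mpfSeries a k (-derivOp) (mulOp g)) = 0) :
    coeff n (∑ j, (a j : ℂ) • midpointSeries g (k j)) = evolutionCoeff g n := by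
  have h₁ : Intertwines (∑ j, (a j : ℂ) • (fe derivOp * (fe ((1 / (2 * k j) : ℂ) • -derivOp) *
      fe ((1 / k j : ℂ) • mulOp g) * fe ((1 / (2 * k j) : ℂ) • -derivOp)) ^ k j))
      (∑ j, (a j : ℂ) • midpointSeries g (k j)) :=
    Intertwines.sum fun j _ => (intertwines_midpointSeries g (k j) (hk j)).smul _
  have h₂ : ∑ j, (a j : ℂ) • (fe derivOp * (fe ((1 / (2 * k j) : ℂ) • -derivOp) *
      fe ((1 / k j : ℂ) • mulOp g) * fe ((1 / (2 * k j) : ℂ) • -derivOp)) ^ k j) =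
      fe derivOp * mpfSeries a k (-derivOp) (mulOp g) +
        fe derivOp * fe (-derivOp + mulOp g) := by
    rw [mpfSeries, ← mul_add, sub_add_cancel, mul_sum]
    simp only [mul_smul_comm]
  have h₃ : coeff n (fe derivOp * mpfSeries a k (-derivOp) (mulOp g)) = 0 := by
    rw [coeff_mul_congr (fun _ _ => rfl) (Q' := 0) (fun i hi => by rw [h i hi, map_zero]),
      mul_zero, map_zero]
  -- Only the value at 0 of the test sequence matters, and here it is 1.
  have h₄ := h₁ n (fun _ => 1)
  rw [h₂, map_add, h₃, zero_add, intertwines_evolution g n, mul_one, mul_one, coeff_mk] at h₄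
  exact h₄.symm

end Transfer

/-! ### Detecting words by Hermitian matrices -/

section Words

open Finset

/-- The adjacency matrix of the edges `{i, i + 1}` labelled `l` of the path `0, …, n` whose edges
are labelled by `w`. -/
def pathMatrix (n : ℕ) (w : ℕ → Fin 2) (l : Fin 2) : Op (n + 1) := fun i j =>
  if ((j : ℕ) = i + 1 ∧ w i = l) ∨ ((i : ℕ) = j + 1 ∧ w j = l) then 1 else 0

theorem isHermitian_pathMatrix (n : ℕ) (w : ℕ → Fin 2) (l : Fin 2) :
    (pathMatrix n w l).IsHermitian := by
  ext i j
  simp only [pathMatrix, Matrix.conjTranspose_apply, apply_ite star, star_one, star_zero]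
  simp only [or_comm]

/-- Each factor moves at most one vertex along the path. To advance by the full length of the word
every factor must step right, so every letter must equal the label of the edge it crosses; the
backward edges, present for symmetry, cannot contribute. -/
theorem pathMatrix_prod (n : ℕ) (w : ℕ → Fin 2) (v : List (Fin 2)) (i j : Fin (n + 1)) :
    ((i : ℕ) + v.length < j → (v.map (pathMatrix n w)).prod i j = 0) ∧
    ((j : ℕ) = i + v.length → (v.map (pathMatrix n w)).prod i j =
      if v = (List.range' i v.length).map w then 1 else 0) := by
  induction v generalizing i with
  | nil =>
    refine ⟨fun h => ?_, fun h => ?_⟩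
    · rw [List.map_nil, List.prod_nil, Matrix.one_apply_ne]
      rintro rfl
      simp at h
    · rw [List.map_nil, List.prod_nil, Fin.ext h.symm]
      simp
  | cons a v ih =>
    rw [List.map_cons, List.prod_cons, Matrix.mul_apply, List.length_cons]
    have hz : ∀ l : Fin (n + 1), (l : ℕ) ≠ i + 1 → (i : ℕ) + (v.length + 1) ≤ j →
        pathMatrix n w a i l * (v.map (pathMatrix n w)).prod l j = 0 := by
      intro l hl hj
      by_cases h : (i : ℕ) = l + 1
      · rw [(ih l).1 (by omega), mul_zero]
      · rw [pathMatrix, if_neg (by omega), zero_mul]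
    refine ⟨fun h => sum_eq_zero fun l _ => ?_, fun h => ?_⟩
    · by_cases hl : (l : ℕ) = i + 1
      · rw [(ih l).1 (by omega), mul_zero]
      · exact hz l hl h.le
    · have hi : (i : ℕ) + 1 < n + 1 := by omega
      rw [sum_eq_single ⟨i + 1, hi⟩ (fun l _ hl => hz l (fun h' => hl (Fin.ext h')) h.ge) (by simp),
        (ih ⟨i + 1, hi⟩).2 (by simp only; omega), List.range'_succ, List.map_cons]
      have hp : pathMatrix n w a i ⟨i + 1, hi⟩ = if a = w i then 1 else 0 := by
        rw [pathMatrix]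
        refine if_congr ⟨?_, fun h => Or.inl ⟨rfl, h.symm⟩⟩ rfl rfl
        rintro (h | h)
        · exact h.2.symm
        · simp only at h
          omega
      rw [hp]
      simp only [List.cons.injEq, ite_and, mul_ite, mul_one, mul_zero]
      split_ifs <;> rfl

/-- The corner entry detects the single word w among all words of length n. The default label 0
belongs to no edge of the path. -/
theorem pathMatrix_prod_ofFn {n : ℕ} (w v : Fin n → Fin 2) (c : ℂ) :
    (List.ofFn fun i => c • pathMatrix n (fun p => if h : p < n then w ⟨p, h⟩ else 0) (v i)).prod
      0 (Fin.last n) = if v = w then c ^ n else 0 := by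
  set w' : ℕ → Fin 2 := fun p => if h : p < n then w ⟨p, h⟩ else 0 with hw'
  have hsmul : ∀ u : List (Fin 2), (u.map fun l => c • pathMatrix n w' l).prod =
      c ^ u.length • (u.map (pathMatrix n w')).prod := by
    intro u
    induction u with
    | nil => simp
    | cons a u ih => simp [ih, pow_succ', smul_smul, mul_comm]
  have hmap : (List.ofFn fun i => c • pathMatrix n w' (v i)) =
      (List.ofFn v).map fun l => c • pathMatrix n w' l := by
    rw [List.map_ofFn]
    rfl
  have hw : (List.range' 0 n).map w' = List.ofFn w := by
    refine List.ext_getElem (by simp) fun p h₁ h₂ => ?_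
    simp only [List.length_map, List.length_range'] at h₁
    simp [hw', h₁]
  have h := (pathMatrix_prod n w' (List.ofFn v) 0 (Fin.last n)).2 (by simp)
  rw [List.length_ofFn, Fin.val_zero, hw] at h
  rw [hmap, hsmul, Matrix.smul_apply, h, List.length_ofFn]
  simp only [List.ofFn_inj, smul_eq_mul, mul_ite, mul_one, mul_zero]

open PowerSeries in
theorem lift_coeff_mpfSeries {M : ℕ} (a : Fin M → ℝ) (k : Fin M → ℕ) (n : ℕ)
    {S : Type*} [Ring S] [Algebra ℂ S] (z : Fin 2 → S) :
    FreeAlgebra.lift ℂ z (coeff n (mpfSeries a k (FreeAlgebra.ι ℂ 0) (FreeAlgebra.ι ℂ 1))) =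
      coeff n (mpfSeries a k (z 0) (z 1)) := by
  have := congrArg (coeff n) (map_mpfSeries (FreeAlgebra.lift ℂ z) a k
    (FreeAlgebra.ι ℂ 0) (FreeAlgebra.ι ℂ 1))
  rw [coeff_map] at this
  simpa using this

open PowerSeries in
/-- Order conditions that hold for all pairs of Hermitian matrices hold in every algebra. -/
theorem coeff_mpfSeries_eq_zero {M : ℕ} {a : Fin M → ℝ} {k : Fin M → ℕ} {n : ℕ}
    (h : ∀ A : Fin 2 → Op (n + 1), (∀ l, (A l).IsHermitian) →
      coeff n (mpfSeries a k (-Complex.I • A 0) (-Complex.I • A 1)) = 0)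
    {R : Type*} [Ring R] [Algebra ℂ R] (x y : R) : coeff n (mpfSeries a k x y) = 0 := by
  set ι : Fin 2 → FreeAlgebra ℂ (Fin 2) := FreeAlgebra.ι ℂ with hι
  -- It suffices to treat the free algebra, which maps to every pair (x, y).
  suffices h0 : coeff n (mpfSeries a k (ι 0) (ι 1)) = 0 by
    have := lift_coeff_mpfSeries a k n ![x, y]
    rw [← hι, h0, map_zero] at this
    exact this.symm
  have hmem : coeff n (mpfSeries a k (ι 0) (ι 1)) ∈
      Submodule.span ℂ (Set.range fun v : Fin n → Fin 2 => (List.ofFn fun i => ι (v i)).prod) := by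
    have := coeff_mpfSeries_mem a k (ι 0) (ι 1) n
    rw [Submodule.span_pow] at this
    refine Submodule.span_mono ?_ this
    intro z hz
    obtain ⟨f, rfl⟩ := Set.mem_pow.1 hz
    have hf : ∀ i, ∃ l, ι l = f i := fun i => by
      rcases (f i).2 with h | h
      · exact ⟨0, h.symm⟩
      · exact ⟨1, h.symm⟩
    choose v hv using hf
    exact ⟨v, by simp only [hv]⟩
  obtain ⟨γ, hγ⟩ := (Submodule.mem_span_range_iff_exists_fun ℂ).1 hmem
  rw [← hγ]
  refine sum_eq_zero fun w _ => ?_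
  suffices γ w = 0 by rw [this, zero_smul]
  -- The path spelling w makes the (0, n) entry equal to γ w (-i)^n.
  set A : Fin 2 → Op (n + 1) := pathMatrix n (fun p => if h : p < n then w ⟨p, h⟩ else 0)
  have h₁ := lift_coeff_mpfSeries a k n (fun l => -Complex.I • A l)
  rw [h A (isHermitian_pathMatrix n _), ← hι, ← hγ, map_sum] at h₁
  have h₂ := congrFun (congrFun h₁ 0) (Fin.last n)
  rw [Matrix.sum_apply] at h₂
  have h₃ : ∀ v : Fin n → Fin 2, (FreeAlgebra.lift ℂ (fun l => -Complex.I • A l)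
      (γ v • (List.ofFn fun i => ι (v i)).prod)) 0 (Fin.last n) =
      if v = w then γ v * (-Complex.I) ^ n else 0 := by
    intro v
    rw [map_smul, map_list_prod, List.map_ofFn, Matrix.smul_apply]
    have := pathMatrix_prod_ofFn w v (-Complex.I)
    simp only [Function.comp_def, ι, FreeAlgebra.lift_ι_apply]
    rw [this]
    simp
  simp only [h₃, sum_ite_eq', Finset.mem_univ, if_true, Matrix.zero_apply] at h₂
  exact (mul_eq_zero.1 h₂).resolve_right (pow_ne_zero _ (neg_ne_zero.2 Complex.I_ne_zero))

end Words

/-! ### Evaluation of formal power series -/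

section Evaluation

open PowerSeries Finset

variable {𝔸 : Type*} [NormedRing 𝔸]

/-- The weighted `ℓ¹` norm `∑ n, ‖P n‖ x ^ n` of the coefficients of `P` is at most `K`. -/
def NormLE (P : 𝔸⟦X⟧) (x K : ℝ) : Prop :=
  (Summable fun n => ‖coeff n P‖ * x ^ n) ∧ ∑' n, ‖coeff n P‖ * x ^ n ≤ K

theorem NormLE.nonneg {P : 𝔸⟦X⟧} {x K : ℝ} (hx : 0 ≤ x) (h : NormLE P x K) : 0 ≤ K :=
  (tsum_nonneg fun _ => by positivity).trans h.2

theorem NormLE.mono {P : 𝔸⟦X⟧} {x K L : ℝ} (h : NormLE P x K) (hKL : K ≤ L) : NormLE P x L :=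
  ⟨h.1, h.2.trans hKL⟩

theorem NormLE.of_le {P : 𝔸⟦X⟧} {x : ℝ} (hx : 0 ≤ x) {b : ℕ → ℝ} (hb : Summable b)
    (h : ∀ n, ‖coeff n P‖ * x ^ n ≤ b n) : NormLE P x (∑' n, b n) := by
  have hs := Summable.of_nonneg_of_le (fun n => by positivity) h hb
  exact ⟨hs, hs.tsum_le_tsum h hb⟩

theorem NormLE.anti {P : 𝔸⟦X⟧} {x y K : ℝ} (h : NormLE P x K) (hy : 0 ≤ y) (hyx : y ≤ x) :
    NormLE P y K :=
  (NormLE.of_le hy h.1 fun n => by gcongr).mono h.2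

theorem NormLE.C (c : 𝔸) (x : ℝ) : NormLE (C c) x ‖c‖ := by
  have h : ∀ n ≠ 0, ‖coeff n (PowerSeries.C c)‖ * x ^ n = 0 := fun n hn => by
    rw [coeff_C_of_ne_zero hn, norm_zero, zero_mul]
  refine ⟨summable_of_ne_finset_zero (s := {0}) fun n hn => h n (by simpa using hn), ?_⟩
  rw [tsum_eq_single 0 h]
  simp

theorem NormLE.add {P Q : 𝔸⟦X⟧} {x K L : ℝ} (hx : 0 ≤ x) (hP : NormLE P x K)
    (hQ : NormLE Q x L) : NormLE (P + Q) x (K + L) := by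
  refine (NormLE.of_le hx (hP.1.add hQ.1) fun n => ?_).mono ?_
  · rw [map_add, ← add_mul]
    gcongr
    exact norm_add_le _ _
  · rw [hP.1.tsum_add hQ.1]
    exact add_le_add hP.2 hQ.2

theorem NormLE.mul {P Q : 𝔸⟦X⟧} {x K L : ℝ} (hx : 0 ≤ x) (hP : NormLE P x K)
    (hQ : NormLE Q x L) : NormLE (P * Q) x (K * L) := by
  have hP' : Summable fun n => ‖‖coeff n P‖ * x ^ n‖ := hP.1.norm
  have hQ' : Summable fun n => ‖‖coeff n Q‖ * x ^ n‖ := hQ.1.norm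
  have hs := (summable_norm_sum_mul_antidiagonal_of_summable_norm hP' hQ').of_norm
  refine (NormLE.of_le hx hs fun n => ?_).mono ?_
  · rw [coeff_mul]
    refine (mul_le_mul_of_nonneg_right (norm_sum_le _ _) (pow_nonneg hx n)).trans ?_
    rw [sum_mul]
    refine sum_le_sum fun ij hij => ?_
    rw [← HasAntidiagonal.mem_antidiagonal.1 hij, pow_add]
    calc _ ≤ (‖coeff ij.1 P‖ * ‖coeff ij.2 Q‖) * (x ^ ij.1 * x ^ ij.2) := by
          gcongr
          exact norm_mul_le _ _
      _ = _ := by ring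
  · rw [← tsum_mul_tsum_eq_tsum_sum_antidiagonal_of_summable_norm hP' hQ']
    exact mul_le_mul hP.2 hQ.2 (tsum_nonneg fun _ => by positivity) (hP.nonneg hx)

theorem NormLE.sum {ι : Type*} {s : Finset ι} {P : ι → 𝔸⟦X⟧} {x : ℝ} {K : ι → ℝ} (hx : 0 ≤ x)
    (h : ∀ i ∈ s, NormLE (P i) x (K i)) : NormLE (∑ i ∈ s, P i) x (∑ i ∈ s, K i) := by
  classical
  induction s using Finset.induction_on with
  | empty => simpa using NormLE.C (0 : 𝔸) x
  | insert i s hi ih =>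
    rw [sum_insert hi, sum_insert hi]
    exact (h i (mem_insert_self i s)).add hx (ih fun j hj => h j (mem_insert_of_mem hj))

section NormOne

variable [NormOneClass 𝔸]

theorem NormLE.one (x : ℝ) : NormLE (1 : 𝔸⟦X⟧) x 1 := by
  simpa using NormLE.C (1 : 𝔸) x

theorem NormLE.X (x : ℝ) : NormLE (X : 𝔸⟦X⟧) x x := by
  have h : ∀ n ≠ 1, ‖coeff n (PowerSeries.X : 𝔸⟦X⟧)‖ * x ^ n = 0 := fun n hn => by
    rw [coeff_X, if_neg hn, norm_zero, zero_mul]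
  refine ⟨summable_of_ne_finset_zero (s := {1}) fun n hn => h n (by simpa using hn), ?_⟩
  rw [tsum_eq_single 1 h]
  simp

theorem NormLE.pow {P : 𝔸⟦X⟧} {x K : ℝ} (hx : 0 ≤ x) (hP : NormLE P x K) (r : ℕ) :
    NormLE (P ^ r) x (K ^ r) := by
  induction r with
  | zero => simpa using NormLE.one x
  | succ r ih => rw [pow_succ, pow_succ]; exact ih.mul hx hP

theorem NormLE.list_prod {P : ℕ → 𝔸⟦X⟧} {x K : ℝ} (hx : 0 ≤ x) {m : ℕ}
    (h : ∀ r < m, NormLE (P r) x K) : NormLE ((List.range m).map P).reverse.prod x (K ^ m) := by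
  induction m with
  | zero => simpa using NormLE.one x
  | succ m ih =>
    simpa [List.range_succ, pow_succ'] using
      (h m m.lt_succ_self).mul hx (ih fun r hr => h r (hr.trans m.lt_succ_self))

end NormOne

variable [NormedAlgebra ℂ 𝔸]

theorem NormLE.smul {P : 𝔸⟦X⟧} {x K : ℝ} (h : NormLE P x K) (c : ℂ) :
    NormLE (c • P) x (‖c‖ * K) := by
  have : (fun n => ‖coeff n (c • P)‖ * x ^ n) = fun n => ‖c‖ * (‖coeff n P‖ * x ^ n) := by
    funext n
    rw [coeff_const_smul, norm_smul, mul_assoc]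
  rw [NormLE, this, tsum_mul_left]
  exact ⟨h.1.mul_left _, mul_le_mul_of_nonneg_left h.2 (norm_nonneg c)⟩

/-- The sum of the power series `P` at `x`. -/
noncomputable def evalAt (P : 𝔸⟦X⟧) (x : ℝ) : 𝔸 := ∑' n, (x : ℂ) ^ n • coeff n P

theorem norm_pow_smul_coeff (P : 𝔸⟦X⟧) {x : ℝ} (hx : 0 ≤ x) (n : ℕ) :
    ‖(x : ℂ) ^ n • coeff n P‖ = ‖coeff n P‖ * x ^ n := by
  rw [norm_smul, norm_pow, Complex.norm_of_nonneg hx, mul_comm]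

theorem NormLE.summable_norm {P : 𝔸⟦X⟧} {x K : ℝ} (hx : 0 ≤ x) (h : NormLE P x K) :
    Summable fun n => ‖(x : ℂ) ^ n • coeff n P‖ := by
  simpa only [norm_pow_smul_coeff P hx] using h.1

theorem NormLE.norm_evalAt_le {P : 𝔸⟦X⟧} {x K : ℝ} (hx : 0 ≤ x) (h : NormLE P x K) :
    ‖evalAt P x‖ ≤ K := by
  rw [evalAt]
  have h' := norm_tsum_le_tsum_norm (f := fun n => (x : ℂ) ^ n • coeff n P) (h.summable_norm hx)
  simp only [norm_pow_smul_coeff P hx] at h'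
  exact h'.trans h.2

/-- For n ≥ N and x ≤ y, (x / y)^n ≤ (x / y)^N. This turns order conditions into an explicit error
bound, with the radius y supplying the scale. -/
theorem NormLE.norm_evalAt_le_of_coeff_eq_zero {P : 𝔸⟦X⟧} {x y K : ℝ} (hx : 0 ≤ x) (hy : 0 < y)
    (hxy : x ≤ y) (h : NormLE P y K) {N : ℕ} (hN : ∀ n < N, coeff n P = 0) :
    ‖evalAt P x‖ ≤ (x / y) ^ N * K := by
  have h' : NormLE P x (∑' n, (x / y) ^ N * (‖coeff n P‖ * y ^ n)) := by
    refine NormLE.of_le hx (h.1.mul_left _) fun n => ?_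
    rcases lt_or_ge n N with hn | hn
    · simp [hN n hn]
    · have : (x / y) ^ n ≤ (x / y) ^ N :=
        pow_le_pow_of_le_one (by positivity) ((div_le_one hy).2 hxy) hn
      calc ‖coeff n P‖ * x ^ n = (x / y) ^ n * (‖coeff n P‖ * y ^ n) := by
            rw [div_pow]
            field_simp
        _ ≤ _ := by gcongr
  rw [tsum_mul_left] at h'
  exact (h'.norm_evalAt_le hx).trans (by have := h.2; gcongr)

theorem evalAt_C (c : 𝔸) (x : ℝ) : evalAt (C c) x = c := by
  rw [evalAt, tsum_eq_single 0]
  · simp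
  · intro n hn
    rw [coeff_C_of_ne_zero hn, smul_zero]

theorem evalAt_X (x : ℝ) : evalAt (X : 𝔸⟦X⟧) x = (x : ℂ) • 1 := by
  rw [evalAt, tsum_eq_single 1]
  · simp
  · intro n hn
    rw [coeff_X, if_neg hn, smul_zero]

variable [CompleteSpace 𝔸]

theorem evalAt_add {P Q : 𝔸⟦X⟧} {x K L : ℝ} (hx : 0 ≤ x) (hP : NormLE P x K)
    (hQ : NormLE Q x L) : evalAt (P + Q) x = evalAt P x + evalAt Q x := by
  simp only [evalAt, map_add, smul_add]
  exact (hP.summable_norm hx).of_norm.tsum_add (hQ.summable_norm hx).of_norm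

theorem evalAt_smul {P : 𝔸⟦X⟧} {x K : ℝ} (hx : 0 ≤ x) (hP : NormLE P x K) (c : ℂ) :
    evalAt (c • P) x = c • evalAt P x := by
  simp only [evalAt, coeff_const_smul, smul_comm _ c]
  exact (hP.summable_norm hx).of_norm.tsum_const_smul c

theorem evalAt_sum {ι : Type*} {s : Finset ι} {P : ι → 𝔸⟦X⟧} {x : ℝ} {K : ι → ℝ} (hx : 0 ≤ x)
    (h : ∀ i ∈ s, NormLE (P i) x (K i)) : evalAt (∑ i ∈ s, P i) x = ∑ i ∈ s, evalAt (P i) x := by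
  simp only [evalAt, map_sum, smul_sum]
  exact Summable.tsum_finsetSum fun i hi => ((h i hi).summable_norm hx).of_norm

theorem evalAt_mul {P Q : 𝔸⟦X⟧} {x K L : ℝ} (hx : 0 ≤ x) (hP : NormLE P x K)
    (hQ : NormLE Q x L) : evalAt (P * Q) x = evalAt P x * evalAt Q x := by
  rw [evalAt, evalAt, evalAt, tsum_mul_tsum_eq_tsum_sum_antidiagonal_of_summable_norm
    (hP.summable_norm hx) (hQ.summable_norm hx)]
  refine tsum_congr fun n => ?_
  rw [coeff_mul, smul_sum]
  refine sum_congr rfl fun ij hij => ?_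
  rw [smul_mul_smul_comm, ← pow_add, HasAntidiagonal.mem_antidiagonal.1 hij]

/-- By induction on n, subtracting the n-th monomial Q leaves a remainder of order n + 1. Dividing
by x^n and letting x → 0 then forces the n-th coefficient to vanish. -/
theorem NormLE.coeff_eq_zero_of_isBigO {P : 𝔸⟦X⟧} {y K : ℝ} (hy : 0 < y) (h : NormLE P y K) {N : ℕ}
    (hO : (fun x => evalAt P x) =O[𝓝[>] 0] fun x : ℝ => x ^ N) : ∀ n < N, coeff n P = 0 := by
  intro n
  induction n using Nat.strong_induction_on with
  | _ n ih =>
    intro hn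
    set Q : 𝔸⟦X⟧ := PowerSeries.C (coeff n P) * PowerSeries.X ^ n with hQ
    have hQc : ∀ m, coeff m Q = if m = n then coeff n P else 0 := fun m => by
      rw [hQ, coeff_C_mul_X_pow]
    have hQN : ∀ x, NormLE Q x (‖coeff n P‖ * x ^ n) := fun x => by
      have h0 : ∀ m ≠ n, ‖coeff m Q‖ * x ^ m = 0 := fun m hm => by
        rw [hQc, if_neg hm, norm_zero, zero_mul]
      refine ⟨summable_of_ne_finset_zero (s := {n}) fun m hm => h0 m (by simpa using hm), ?_⟩
      rw [tsum_eq_single n h0, hQc, if_pos rfl]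
    have hQe : ∀ x : ℝ, evalAt Q x = (x : ℂ) ^ n • coeff n P := fun x => by
      rw [evalAt, tsum_eq_single n, hQc, if_pos rfl]
      intro m hm
      rw [hQc, if_neg hm, smul_zero]
    set L := K + ‖(-1 : ℂ)‖ * (‖coeff n P‖ * y ^ n)
    have hPQ : NormLE (P + (-1 : ℂ) • Q) y L := h.add hy.le ((hQN y).smul (-1))
    have hzero : ∀ m < n + 1, coeff m (P + (-1 : ℂ) • Q) = 0 := fun m hm => by
      rw [map_add, coeff_const_smul, hQc]
      rcases eq_or_ne m n with rfl | hmn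
      · simp
      · rw [ih m (by omega) (by omega), if_neg hmn]
        simp
    obtain ⟨c, hc⟩ := hO.bound
    have hev : ∀ᶠ x : ℝ in 𝓝[>] 0, ‖coeff n P‖ ≤ x * (|c| + L / y ^ (n + 1)) := by
      have hlt : ∀ᶠ x : ℝ in 𝓝[>] 0, x < min y 1 :=
        (eventually_lt_nhds (lt_min hy one_pos)).filter_mono nhdsWithin_le_nhds
      filter_upwards [hc, hlt, self_mem_nhdsWithin] with x hx hxy hx0
      have hx0 : 0 < x := hx0
      have hxy' : x ≤ y := (hxy.le.trans (min_le_left _ _))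
      have hx1 : x ≤ 1 := (hxy.le.trans (min_le_right _ _))
      have h₁ := hPQ.norm_evalAt_le_of_coeff_eq_zero hx0.le hy hxy' hzero
      rw [evalAt_add hx0.le (h.anti hx0.le hxy') ((hQN x).smul _),
        evalAt_smul hx0.le (hQN x), hQe] at h₁
      have h₂ : x ^ n * ‖coeff n P‖ ≤ |c| * x ^ N + (x / y) ^ (n + 1) * L := by
        have e : (x : ℂ) ^ n • coeff n P =
            evalAt P x - (evalAt P x + (-1 : ℂ) • (x : ℂ) ^ n • coeff n P) := by
          simp
        rw [mul_comm, ← norm_pow_smul_coeff P hx0.le, e]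
        refine (norm_sub_le _ _).trans (add_le_add (hx.trans ?_) h₁)
        rw [Real.norm_of_nonneg (by positivity)]
        gcongr
        exact le_abs_self c
      have h₃ : x ^ N ≤ x ^ (n + 1) := pow_le_pow_of_le_one hx0.le hx1 hn
      have h₄ : x ^ n * ‖coeff n P‖ ≤ x ^ n * (x * (|c| + L / y ^ (n + 1))) := by
        refine h₂.trans ?_
        calc |c| * x ^ N + (x / y) ^ (n + 1) * L ≤ |c| * x ^ (n + 1) + (x / y) ^ (n + 1) * L := by
              gcongr
          _ = _ := by rw [div_pow]; ring
      exact le_of_mul_le_mul_left h₄ (by positivity)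
    have hlim : Tendsto (fun x : ℝ => x * (|c| + L / y ^ (n + 1))) (𝓝[>] 0) (𝓝 0) := by
      have : Tendsto (fun x : ℝ => x * (|c| + L / y ^ (n + 1))) (𝓝 0) (𝓝 (0 * _)) :=
        tendsto_id.mul_const _
      rw [zero_mul] at this
      exact this.mono_left nhdsWithin_le_nhds
    exact norm_le_zero_iff.1 (ge_of_tendsto hlim hev)

variable [NormOneClass 𝔸]

theorem evalAt_pow {P : 𝔸⟦X⟧} {x K : ℝ} (hx : 0 ≤ x) (hP : NormLE P x K) (r : ℕ) :
    evalAt (P ^ r) x = evalAt P x ^ r := by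
  induction r with
  | zero => simpa using evalAt_C (1 : 𝔸) x
  | succ r ih => rw [pow_succ, pow_succ, evalAt_mul hx (hP.pow hx r) hP, ih]

theorem evalAt_list_prod {P : ℕ → 𝔸⟦X⟧} {x K : ℝ} (hx : 0 ≤ x) {m : ℕ}
    (h : ∀ r < m, NormLE (P r) x K) : evalAt ((List.range m).map P).reverse.prod x =
      ((List.range m).map fun r => evalAt (P r) x).reverse.prod := by
  induction m with
  | zero => simpa using evalAt_C (1 : 𝔸) x
  | succ m ih =>
    have h' : ∀ r < m, NormLE (P r) x K := fun r hr => h r (hr.trans m.lt_succ_self)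
    have := evalAt_mul hx (h m m.lt_succ_self) (NormLE.list_prod hx h')
    rw [ih h'] at this
    simpa [List.range_succ] using this

/-- Both claims come from exchanging the two sums over powers n and degrees m. The double family is
absolutely summable because the n-th power contributes at most (xK)^n / n!. -/
theorem NormLE.fexp_and_evalAt_fexp {P : 𝔸⟦X⟧} {x K : ℝ} (hx : 0 ≤ x) (hP : NormLE P x K) :
    NormLE (fexp P) x (Real.exp (x * K)) ∧
      evalAt (fexp P) x = NormedSpace.exp ((x : ℂ) • evalAt P x) := by
  set S : ℕ → 𝔸⟦X⟧ := fun n => ((n.factorial : ℂ)⁻¹) • (PowerSeries.X * P) ^ n with hS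
  have hXP : NormLE (PowerSeries.X * P) x (x * K) := (NormLE.X x).mul hx hP
  have hSn : ∀ n, NormLE (S n) x ((n.factorial : ℝ)⁻¹ * (x * K) ^ n) := fun n => by
    have := (hXP.pow hx n).smul ((n.factorial : ℂ)⁻¹)
    rwa [norm_inv, Complex.norm_natCast] at this
  have hexp : HasSum (fun n : ℕ => (n.factorial : ℝ)⁻¹ * (x * K) ^ n) (Real.exp (x * K)) := by
    rw [Real.exp_eq_exp_ℝ]
    simpa using NormedSpace.exp_series_hasSum_exp' (𝕂 := ℝ) (x * K)
  have hzero : ∀ m, ∀ n ∉ range (m + 1), coeff m (S n) = 0 := fun m n hn => by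
    rw [hS]
    simp only
    rw [coeff_const_smul, coeff_X_mul_pow_of_lt P (by simpa using hn), smul_zero]
  have hcoeff : ∀ m, coeff m (fexp P) = ∑' n, coeff m (S n) := fun m => by
    rw [tsum_eq_sum (hzero m), coeff_fexp P m.lt_succ_self, map_sum]
  have hsum : Summable fun nm : ℕ × ℕ => ‖coeff nm.2 (S nm.1)‖ * x ^ nm.2 := by
    refine (summable_prod_of_nonneg fun nm => ?_).2 ⟨fun n => (hSn n).1, ?_⟩
    · positivity
    · exact Summable.of_nonneg_of_le (fun n => tsum_nonneg fun m => by positivity)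
        (fun n => (hSn n).2) hexp.summable
  have hsum' : Summable fun nm : ℕ × ℕ => (x : ℂ) ^ nm.2 • coeff nm.2 (S nm.1) := by
    refine Summable.of_norm ?_
    simpa only [norm_pow_smul_coeff _ hx] using hsum
  refine ⟨(NormLE.of_le hx hsum.prod_symm.prod fun m => ?_).mono ?_, ?_⟩
  · rw [hcoeff]
    simp only [Prod.swap_prod_mk]
    rw [tsum_mul_right]
    gcongr
    refine norm_tsum_le_tsum_norm ?_
    exact summable_of_ne_finset_zero fun n hn => by rw [hzero m n hn, norm_zero]
  · simp only [Prod.swap_prod_mk]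
    rw [Summable.tsum_comm (f := fun n m => ‖coeff m (S n)‖ * x ^ m) hsum, ← hexp.tsum_eq]
    exact hsum.prod.tsum_le_tsum (fun n => (hSn n).2) hexp.summable
  · have h₁ : evalAt (fexp P) x = ∑' m, ∑' n, (x : ℂ) ^ m • coeff m (S n) := by
      refine tsum_congr fun m => ?_
      rw [hcoeff, Summable.tsum_const_smul]
      exact summable_of_ne_finset_zero (hzero m)
    rw [h₁, Summable.tsum_comm (f := fun n m => (x : ℂ) ^ m • coeff m (S n)) hsum',
      NormedSpace.exp_eq_tsum ℂ]
    refine tsum_congr fun n => ?_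
    change evalAt (S n) x = _
    rw [hS]
    simp only
    rw [evalAt_smul hx (hXP.pow hx n), evalAt_pow hx hXP, evalAt_mul hx (NormLE.X x) hP, evalAt_X,
      smul_one_mul]

theorem NormLE.fexp {P : 𝔸⟦X⟧} {x K : ℝ} (hx : 0 ≤ x) (hP : NormLE P x K) :
    NormLE (fexp P) x (Real.exp (x * K)) := (hP.fexp_and_evalAt_fexp hx).1

theorem evalAt_fexp {P : 𝔸⟦X⟧} {x K : ℝ} (hx : 0 ≤ x) (hP : NormLE P x K) :
    evalAt (MPF.fexp P) x = NormedSpace.exp ((x : ℂ) • evalAt P x) :=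
  (hP.fexp_and_evalAt_fexp hx).2

theorem NormLE.fe (y : 𝔸) {x : ℝ} (hx : 0 ≤ x) : NormLE (fe y) x (Real.exp (x * ‖y‖)) := by
  rw [← fexp_C]
  exact (NormLE.C y x).fexp hx

theorem evalAt_fe (y : 𝔸) {x : ℝ} (hx : 0 ≤ x) :
    evalAt (MPF.fe y) x = NormedSpace.exp ((x : ℂ) • y) := by
  rw [← fexp_C, evalAt_fexp hx (NormLE.C y x), evalAt_C]

end Evaluation

/-! ### Order conditions of multiproduct data -/

section OrderConditions

open PowerSeries Finset

variable {𝔸 : Type*} [NormedRing 𝔸] [NormOneClass 𝔸] [NormedAlgebra ℂ 𝔸] [CompleteSpace 𝔸]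

theorem normLE_evalAt_mpfSeries {M : ℕ} (a : Fin M → ℝ) (k : Fin M → ℕ) (X Y : 𝔸) {x : ℝ}
    (hx : 0 ≤ x) : (∃ K, NormLE (mpfSeries a k X Y) x K) ∧
      evalAt (mpfSeries a k X Y) x = ∑ j, (a j : ℂ) •
        (NormedSpace.exp ((x : ℂ) • (1 / (2 * k j) : ℂ) • X) *
          NormedSpace.exp ((x : ℂ) • (1 / k j : ℂ) • Y) *
          NormedSpace.exp ((x : ℂ) • (1 / (2 * k j) : ℂ) • X)) ^ k j -
        NormedSpace.exp ((x : ℂ) • (X + Y)) := by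
  have h₁ := fun j => ((NormLE.fe ((1 / (2 * k j) : ℂ) • X) hx).mul hx
    (NormLE.fe ((1 / k j : ℂ) • Y) hx))
  have h₂ := fun j => (h₁ j).mul hx (NormLE.fe ((1 / (2 * k j) : ℂ) • X) hx)
  have h₃ := fun j => ((h₂ j).pow hx (k j)).smul (a j : ℂ)
  have h₄ := NormLE.sum (s := univ) hx fun j _ => h₃ j
  have h₅ := (NormLE.fe (X + Y) hx).smul (-1)
  have h₆ : mpfSeries a k X Y = ∑ j, (a j : ℂ) • (fe ((1 / (2 * k j) : ℂ) • X) *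
      fe ((1 / k j : ℂ) • Y) * fe ((1 / (2 * k j) : ℂ) • X)) ^ k j + (-1 : ℂ) • fe (X + Y) := by
    rw [mpfSeries, neg_one_smul, sub_eq_add_neg]
  rw [h₆]
  refine ⟨⟨_, h₄.add hx h₅⟩, ?_⟩
  rw [evalAt_add hx h₄ h₅, evalAt_sum hx fun j _ => h₃ j, evalAt_smul hx (NormLE.fe (X + Y) hx),
    neg_one_smul, ← sub_eq_add_neg, evalAt_fe _ hx]
  congr 1
  refine sum_congr rfl fun j _ => ?_
  rw [evalAt_smul hx ((h₂ j).pow hx (k j)), evalAt_pow hx (h₂ j),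
    evalAt_mul hx (h₁ j) (NormLE.fe _ hx), evalAt_mul hx (NormLE.fe _ hx) (NormLE.fe _ hx),
    evalAt_fe _ hx, evalAt_fe _ hx]

/-- With two summands the two middle half-steps of A 1 commute and merge, so the Trotter–Suzuki
formula is the Strang splitting. -/
theorem timeIndependentMPF_sub_exp {d M : ℕ} [NeZero d] (a : Fin M → ℝ) (k : Fin M → ℕ)
    (A : Fin 2 → Op d) {t : ℝ} (ht : 0 ≤ t) :
    timeIndependentMPF a k A t - NormedSpace.exp ((-Complex.I * (t : ℂ)) • ∑ l, A l) =
      evalAt (mpfSeries a k (-Complex.I • A 0) (-Complex.I • A 1)) t := by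
  let : NormedAlgebra ℚ (Op d) := NormedAlgebra.restrictScalars ℚ ℂ (Op d)
  rw [(normLE_evalAt_mpfSeries a k _ _ ht).2, timeIndependentMPF, Fin.sum_univ_two]
  congr 1
  · refine sum_congr rfl fun j _ => ?_
    congr 2
    have h₁ : (-Complex.I * ((t / k j / 2 : ℝ) : ℂ)) • A 1 +
        (-Complex.I * ((t / k j / 2 : ℝ) : ℂ)) • A 1 =
        (t : ℂ) • (1 / k j : ℂ) • -Complex.I • A 1 := by
      rw [← add_smul, smul_smul, smul_smul]
      congr 1
      push_cast
      ring
    have h₀ : (-Complex.I * ((t / k j / 2 : ℝ) : ℂ)) • A 0 =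
        (t : ℂ) • (1 / (2 * k j) : ℂ) • -Complex.I • A 0 := by
      rw [smul_smul, smul_smul]
      congr 1
      push_cast
      ring
    rw [← h₁, NormedSpace.exp_add_of_commute (Commute.refl _), ← h₀]
    simp [trotter2, mul_assoc]
  · rw [← smul_add, smul_smul, mul_comm]

/-- The order conditions of multiproduct data hold in every algebra. -/
theorem IsMPFData.coeff_mpfSeries {M : ℕ} {a : Fin M → ℝ} {k : Fin M → ℕ} (h : IsMPFData a k)
    {R : Type*} [Ring R] [Algebra ℂ R] (x y : R) {n : ℕ} (hn : n ≤ 2 * M) :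
    coeff n (mpfSeries a k x y) = 0 := by
  refine coeff_mpfSeries_eq_zero (fun A hA => ?_) x y
  obtain ⟨K, hK⟩ := (normLE_evalAt_mpfSeries a k (-Complex.I • A 0) (-Complex.I • A 1)
    zero_le_one).1
  -- The series converges at every radius; radius 1 is an arbitrary choice.
  refine hK.coeff_eq_zero_of_isBigO one_pos (N := 2 * M + 1) ?_ n (Nat.lt_succ_of_le hn)
  refine (h.2 (n + 1) 2 A hA).congr' ?_ EventuallyEq.rfl
  filter_upwards [self_mem_nhdsWithin] with t ht
  exact timeIndependentMPF_sub_exp a k A (le_of_lt ht)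

theorem IsMPFData.sum_eq_one {M : ℕ} {a : Fin M → ℝ} {k : Fin M → ℕ} (h : IsMPFData a k) :
    ∑ j, a j = 1 := by
  -- At x = y = 0 every exponential is 1, so the degree-0 condition is ∑ a_j - 1 = 0.
  have h0 := h.coeff_mpfSeries (0 : ℂ) 0 (Nat.zero_le _)
  simp only [mpfSeries, smul_zero, fe_zero, add_zero, mul_one, one_pow] at h0
  rw [map_sub, map_sum] at h0
  simp only [coeff_const_smul, coeff_one, if_pos, smul_eq_mul, mul_one] at h0
  exact_mod_cast sub_eq_zero.1 h0

theorem IsMPFData.one_le_sum_abs {M : ℕ} {a : Fin M → ℝ} {k : Fin M → ℕ} (h : IsMPFData a k) :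
    1 ≤ ∑ j, |a j| :=
  h.sum_eq_one ▸ sum_le_sum fun j _ => le_abs_self (a j)

end OrderConditions

/-! ### Taylor series of the midpoint formula and of the evolution -/

section TaylorBounds

open PowerSeries Finset

variable {𝔸 : Type*} [NormedRing 𝔸] [NormedAlgebra ℂ 𝔸]

theorem NormLE.taylorSeries {g : ℕ → 𝔸} {L : ℝ} (hg : ∀ p, ‖g p‖ ≤ L ^ (p + 1)) (_ : 0 ≤ L)
    {c : ℂ} (hc : ‖c‖ ≤ 1) {x : ℝ} (hx : 0 ≤ x) :
    NormLE (taylorSeries g c) x (L * Real.exp (L * x)) := by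
  have hexp : HasSum (fun n : ℕ => L * ((n.factorial : ℝ)⁻¹ * (L * x) ^ n))
      (L * Real.exp (L * x)) := by
    refine HasSum.mul_left L ?_
    rw [Real.exp_eq_exp_ℝ]
    simpa using NormedSpace.exp_series_hasSum_exp' (𝕂 := ℝ) (L * x)
  refine (NormLE.of_le hx hexp.summable fun p => ?_).mono hexp.tsum_eq.le
  rw [MPF.taylorSeries, coeff_mk, norm_smul, norm_div, norm_pow, Complex.norm_natCast]
  calc ‖c‖ ^ p / p.factorial * ‖g p‖ * x ^ p ≤ 1 ^ p / p.factorial * L ^ (p + 1) * x ^ p := by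
        gcongr
        exact hg p
    _ = _ := by
        rw [mul_pow, pow_succ, one_pow]
        ring

theorem norm_coeff_midpoint_le {r k : ℕ} (hr : r < k) : ‖((r + 1 / 2) / k : ℂ)‖ ≤ 1 := by
  have hk : (0 : ℝ) < k := mod_cast (Nat.zero_le r).trans_lt hr
  have hrk : (r : ℝ) + 1 ≤ k := mod_cast hr
  have : ((r + 1 / 2) / k : ℂ) = (((r + 1 / 2) / k : ℝ) : ℂ) := by push_cast; rfl
  rw [this, Complex.norm_of_nonneg (by positivity), div_le_one hk]
  linarith

theorem norm_evolutionCoeff_succ_le {g : ℕ → 𝔸} {L : ℝ} (hg : ∀ p, ‖g p‖ ≤ L ^ (p + 1))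
    {b : ℕ → ℝ} {n : ℕ} (hb : ∀ m ≤ n, ‖evolutionCoeff g m‖ ≤ b m) :
    (n + 1) * ‖evolutionCoeff g (n + 1)‖ ≤
      ∑ i ∈ range (n + 1), L ^ (i + 1) / i.factorial * b (n - i) := by
  have h := congrArg norm (evolutionCoeff_succ g n)
  have hn : ‖(n : ℂ) + 1‖ = (n : ℝ) + 1 := by
    exact_mod_cast Complex.norm_natCast (n + 1)
  rw [norm_smul, hn] at h
  rw [h, coeff_mul, Nat.sum_antidiagonal_eq_sum_range_succ_mk]
  refine (norm_sum_le _ _).trans (sum_le_sum fun i hi => ?_)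
  rw [taylorSeries, coeff_mk, coeff_mk, one_pow, smul_mul_assoc, norm_smul, norm_div, norm_one,
    Complex.norm_natCast, div_mul_eq_mul_div, one_mul, div_mul_eq_mul_div]
  refine div_le_div_of_nonneg_right ((norm_mul_le _ _).trans ?_) (Nat.cast_nonneg _)
  exact mul_le_mul (hg i) (hb _ (Nat.sub_le n i)) (norm_nonneg _) ((norm_nonneg _).trans (hg i))

variable [NormOneClass 𝔸]

theorem norm_evolutionCoeff_le {g : ℕ → 𝔸} {L : ℝ} (hg : ∀ p, ‖g p‖ ≤ L ^ (p + 1)) (hL : 0 ≤ L)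
    (n : ℕ) : ‖evolutionCoeff g n‖ ≤ L ^ n := by
  induction n using Nat.strong_induction_on with
  | _ n ih =>
    cases n with
    | zero => simp [evolutionCoeff]
    | succ n =>
      have h := norm_evolutionCoeff_succ_le hg (b := fun m => L ^ m)
        fun m hm => ih m (Nat.lt_succ_of_le hm)
      refine le_of_mul_le_mul_left (h.trans ?_) (Nat.cast_add_one_pos n)
      calc ∑ i ∈ range (n + 1), L ^ (i + 1) / i.factorial * L ^ (n - i)
          ≤ ∑ i ∈ range (n + 1), L ^ (n + 1) := by
            refine sum_le_sum fun i hi => ?_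
            have hi' : i + 1 + (n - i) = n + 1 := by
              have := Finset.mem_range.1 hi
              omega
            rw [div_mul_eq_mul_div, ← pow_add, hi']
            exact div_le_self (by positivity) (mod_cast i.factorial_pos)
        _ = (n + 1) * L ^ (n + 1) := by simp

/-- The bound L^n alone does not give convergence at radius 1/L, so the ratio is improved to L/2.
The recursion loses a factor 2 ∑ 2^i / i! ≤ 2e² ≤ 16 and gains 1/n, so the induction closes for n ≥
16; the constant 2^15 covers n ≤ 15. -/
theorem norm_evolutionCoeff_le_geometric {g : ℕ → 𝔸} {L : ℝ} (hg : ∀ p, ‖g p‖ ≤ L ^ (p + 1))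
    (hL : 0 ≤ L) (n : ℕ) : ‖evolutionCoeff g n‖ ≤ 2 ^ 15 * (L / 2) ^ n := by
  induction n using Nat.strong_induction_on with
  | _ n ih =>
    rcases le_or_gt n 15 with hn | hn
    · calc ‖evolutionCoeff g n‖ ≤ L ^ n := norm_evolutionCoeff_le hg hL n
        _ = 2 ^ n * (L / 2) ^ n := by rw [← mul_pow, mul_div_cancel₀ L two_ne_zero]
        _ ≤ _ := by
          gcongr
          norm_num
    · obtain ⟨m, rfl⟩ : ∃ m, n = m + 1 := ⟨n - 1, by omega⟩
      have h := norm_evolutionCoeff_succ_le hg (b := fun m => 2 ^ 15 * (L / 2) ^ m)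
        fun m hm => ih m (Nat.lt_succ_of_le hm)
      refine le_of_mul_le_mul_left (h.trans ?_) (Nat.cast_add_one_pos m)
      have hexp : Real.exp 2 ≤ 8 := by
        have h1 := Real.exp_one_lt_d9
        have h2 : Real.exp 2 = Real.exp 1 * Real.exp 1 := by
          rw [← Real.exp_add]
          norm_num
        have h3 := Real.exp_pos 1
        rw [h2]
        nlinarith
      have hm : (15 : ℝ) ≤ m := mod_cast Nat.le_of_lt_succ hn
      calc ∑ i ∈ range (m + 1), L ^ (i + 1) / i.factorial * (2 ^ 15 * (L / 2) ^ (m - i))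
          = 2 ^ 15 * (L / 2) ^ (m + 1) * 2 * ∑ i ∈ range (m + 1), 2 ^ i / (i.factorial : ℝ) := by
            rw [mul_sum]
            refine sum_congr rfl fun i hi => ?_
            have hi' : m + 1 = i + 1 + (m - i) := by
              have := Finset.mem_range.1 hi
              omega
            have hL' : L ^ (i + 1) = (L / 2) ^ (i + 1) * 2 ^ (i + 1) := by
              rw [← mul_pow, div_mul_cancel₀ L two_ne_zero]
            rw [hi', hL', pow_add (L / 2) (i + 1)]
            ring
        _ ≤ 2 ^ 15 * (L / 2) ^ (m + 1) * 2 * 8 := by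
            gcongr
            exact (Real.sum_le_exp_of_nonneg zero_le_two _).trans hexp
        _ = 16 * (2 ^ 15 * (L / 2) ^ (m + 1)) := by ring
        _ ≤ (m + 1) * (2 ^ 15 * (L / 2) ^ (m + 1)) := by
            gcongr
            linarith

theorem normLE_evolutionCoeff {g : ℕ → 𝔸} {L : ℝ} (hg : ∀ p, ‖g p‖ ≤ L ^ (p + 1)) (hL : 0 ≤ L)
    {x : ℝ} (hx : 0 ≤ x) (hLx : L * x ≤ 1) :
    NormLE (mk (evolutionCoeff g)) x (2 ^ 16) := by
  have hs : HasSum (fun n : ℕ => (2 : ℝ) ^ 15 * (1 / 2) ^ n) (2 ^ 15 * 2) :=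
    hasSum_geometric_two.mul_left _
  refine (NormLE.of_le hx hs.summable fun n => ?_).mono (hs.tsum_eq.le.trans (by norm_num))
  rw [coeff_mk]
  calc ‖evolutionCoeff g n‖ * x ^ n ≤ 2 ^ 15 * (L / 2) ^ n * x ^ n := by
        gcongr
        exact norm_evolutionCoeff_le_geometric hg hL n
    _ = 2 ^ 15 * (L * x * (1 / 2)) ^ n := by
        rw [mul_assoc, ← mul_pow]
        ring_nf
    _ ≤ 2 ^ 15 * (1 * (1 / 2)) ^ n := by gcongr
    _ = _ := by rw [one_mul]

variable [CompleteSpace 𝔸]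

/-- There are k factors, each with exponent carrying 1/k, so the bound does not depend on k. -/
theorem normLE_midpointSeries_and_evalAt {g : ℕ → 𝔸} {L : ℝ} (hg : ∀ p, ‖g p‖ ≤ L ^ (p + 1))
    (hL : 0 ≤ L) {k : ℕ} (hk : k ≠ 0) {x : ℝ} (hx : 0 ≤ x) :
    NormLE (midpointSeries g k) x (Real.exp (x * (L * Real.exp (L * x)))) ∧
      evalAt (midpointSeries g k) x = ((List.range k).map fun r : ℕ => NormedSpace.exp
        ((x : ℂ) • (1 / k : ℂ) • evalAt (taylorSeries g ((r + 1 / 2) / k)) x)).reverse.prod := by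
  have hk' : (k : ℝ) ≠ 0 := mod_cast hk
  have h₀ : ∀ r < k, NormLE (taylorSeries g ((r + 1 / 2) / k)) x (L * Real.exp (L * x)) :=
    fun r hr => NormLE.taylorSeries hg hL (norm_coeff_midpoint_le hr) hx
  have h₁ := fun r hr => (h₀ r hr).smul (1 / k : ℂ)
  have h₂ : ∀ r < k, NormLE (fexp ((1 / k : ℂ) • taylorSeries g ((r + 1 / 2) / k))) x _ :=
    fun r hr => (h₁ r hr).fexp hx
  constructor
  · have h := NormLE.list_prod
      (P := fun r : ℕ => fexp ((1 / k : ℂ) • taylorSeries g ((r + 1 / 2) / k))) hx h₂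
    rw [← Real.exp_nat_mul, norm_div, norm_one, Complex.norm_natCast] at h
    refine h.mono (le_of_eq ?_)
    congr 1
    field_simp
  · rw [midpointSeries, evalAt_list_prod
      (P := fun r : ℕ => fexp ((1 / k : ℂ) • taylorSeries g ((r + 1 / 2) / k))) hx h₂]
    congr 2
    refine List.map_congr_left fun r hr => ?_
    have hr := List.mem_range.1 hr
    rw [evalAt_fexp hx (h₁ r hr), evalAt_smul hx (h₀ r hr)]

end TaylorBounds

/-! ### Termwise differentiation, and analyticity of the Hamiltonian. -/

section Hamiltonian

open PowerSeries

variable {d : ℕ}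

theorem hasDerivAt_evalAt {P : (Op d)⟦X⟧} {B ρ R : ℝ} (hP : ∀ n, ‖coeff n P‖ ≤ B * ρ ^ n)
    (hρ : 0 ≤ ρ) (hR : ρ * R < 1) {x : ℝ} (hx : |x| < R) :
    HasDerivAt (evalAt P) (evalAt (mk fun n => ((n : ℂ) + 1) • coeff (n + 1) P) x) x := by
  have hR0 : 0 < R := (abs_nonneg x).trans_lt hx
  have hB : 0 ≤ B := by simpa using (norm_nonneg _).trans (hP 0)
  have hmem : ∀ y, y ∈ Metric.ball (0 : ℝ) R ↔ |y| < R := fun y => by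
    rw [Metric.mem_ball, Real.dist_eq, sub_zero]
  have hu : Summable fun n : ℕ => B * R⁻¹ * ((n : ℝ) ^ 1 * (ρ * R) ^ n) := by
    have hn : ‖ρ * R‖ < 1 := by rwa [Real.norm_of_nonneg (by positivity)]
    exact (summable_pow_mul_geometric_of_norm_lt_one 1 hn).mul_left (B * R⁻¹)
  have hder : ∀ (n : ℕ) (y : ℝ), HasDerivAt (fun y : ℝ => (y : ℂ) ^ n • coeff n P)
      (((n : ℂ) * (y : ℂ) ^ (n - 1)) • coeff n P) y := fun n y => by
    have h := ((hasDerivAt_id y).ofReal_comp.pow n).smul_const (coeff n P)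
    simpa using h
  have hbd : ∀ (n : ℕ) (y : ℝ), |y| < R →
      ‖((n : ℂ) * (y : ℂ) ^ (n - 1)) • coeff n P‖ ≤ B * R⁻¹ * ((n : ℝ) ^ 1 * (ρ * R) ^ n) := by
    intro n y hy
    rw [norm_smul, norm_mul, norm_pow, Complex.norm_natCast, Complex.norm_real, Real.norm_eq_abs]
    cases n with
    | zero => simp
    | succ n =>
      calc ((n + 1 : ℕ) : ℝ) * |y| ^ n * ‖coeff (n + 1) P‖
          ≤ ((n + 1 : ℕ) : ℝ) * R ^ n * (B * ρ ^ (n + 1)) := by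
            gcongr
            exact hP _
        _ = _ := by
            rw [mul_pow, pow_succ R]
            field_simp
  have key := hasDerivAt_tsum_of_isPreconnected hu Metric.isOpen_ball
    (convex_ball (0 : ℝ) R).isPreconnected (fun n y _ => hder n y)
    (fun n y hy => hbd n y ((hmem y).1 hy)) ((hmem 0).2 (by simpa using hR0))
    (summable_of_ne_finset_zero (s := {0}) fun n hn => by
      rw [Complex.ofReal_zero, zero_pow (by simpa using hn), zero_smul]) ((hmem x).2 hx)
  have hs : Summable fun n : ℕ => ((n : ℂ) * (x : ℂ) ^ (n - 1)) • coeff n P :=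
    Summable.of_norm_bounded hu fun n => hbd n x hx
  rw [hs.tsum_eq_zero_add] at key
  simp only [Nat.cast_zero, zero_mul, zero_smul, zero_add] at key
  have e : (fun n : ℕ => (((n + 1 : ℕ) : ℂ) * (x : ℂ) ^ (n + 1 - 1)) • coeff (n + 1) P) =
      fun n => (x : ℂ) ^ n • coeff n (mk fun n => ((n : ℂ) + 1) • coeff (n + 1) P) := by
    funext n
    rw [coeff_mk, smul_smul, Nat.add_sub_cancel, mul_comm]
    push_cast
    rfl
  rw [e] at key
  exact key

/-- A function whose derivatives at all points of `[0, T]` satisfy `‖∂ᵖ H‖ ≤ L ^ (p + 1)` is the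
sum of its Taylor series. -/
theorem evalAt_taylorSeries {H : ℝ → Op d} {T L : ℝ} (hT : 0 ≤ T)
    (hH : ContDiffOn ℝ (⊤ : ℕ∞) H (Icc 0 T))
    (hb : ∀ p, ∀ t ∈ Icc 0 T, ‖iteratedDerivWithin p H (Icc 0 T) t‖ ≤ L ^ (p + 1)) (hL : 0 ≤ L)
    {c x : ℝ} (hc : c ∈ Icc (0 : ℝ) 1) (hx : x ∈ Icc 0 T) :
    evalAt (taylorSeries (fun p => -Complex.I • iteratedDerivWithin p H (Icc 0 T) 0) c) x =
      -Complex.I • H (c * x) := by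
  have hcx : c * x ∈ Icc 0 T :=
    ⟨mul_nonneg hc.1 hx.1, (mul_le_of_le_one_left hx.1 hc.2).trans hx.2⟩
  have hg : ∀ p, ‖-Complex.I • iteratedDerivWithin p H (Icc 0 T) 0‖ ≤ L ^ (p + 1) := fun p => by
    rw [norm_smul, norm_neg, Complex.norm_I, one_mul]
    exact hb p 0 ⟨le_rfl, hT⟩
  have hc' : ‖(c : ℂ)‖ ≤ 1 := by
    rw [Complex.norm_of_nonneg hc.1]
    exact hc.2
  have hs := ((NormLE.taylorSeries hg hL hc' hx.1).summable_norm hx.1).of_norm.hasSum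
  -- The shift by one matches the Taylor polynomial of degree n, which has n + 1 terms.
  refine tendsto_nhds_unique (hs.tendsto_sum_nat.comp (tendsto_add_atTop_nat 1)) ?_
  have hpart : ∀ n, ∑ p ∈ Finset.range (n + 1), (x : ℂ) ^ p • coeff p
      (taylorSeries (fun p => -Complex.I • iteratedDerivWithin p H (Icc 0 T) 0) (c : ℂ)) =
      -Complex.I • taylorWithinEval H n (Icc 0 T) 0 (c * x) := fun n => by
    rw [taylor_within_apply, Finset.smul_sum]
    refine Finset.sum_congr rfl fun p _ => ?_
    rw [taylorSeries, coeff_mk, smul_smul, smul_comm, sub_zero,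
      ← Complex.coe_smul ((p.factorial : ℝ)⁻¹ * (c * x) ^ p)]
    congr 2
    push_cast
    rw [mul_pow]
    ring
  have hlim : Tendsto (fun n => taylorWithinEval H n (Icc 0 T) 0 (c * x)) atTop (𝓝 (H (c * x))) := by
    rw [tendsto_iff_norm_sub_tendsto_zero]
    have h0 : Tendsto (fun n : ℕ => L ^ 2 * (c * x) * ((L * (c * x)) ^ n / n.factorial)) atTop
        (𝓝 0) := by
      simpa using (FloorSemiring.tendsto_pow_div_factorial_atTop (L * (c * x))).const_mul
        (L ^ 2 * (c * x))
    refine squeeze_zero (fun n => norm_nonneg _) (fun n => ?_) h0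
    rw [norm_sub_rev]
    refine (taylor_mean_remainder_bound hT (hH.of_le ?_) hcx (hb (n + 1))).trans (le_of_eq ?_)
    · exact_mod_cast le_top
    · rw [sub_zero]
      ring
  simp only [Function.comp_def, hpart]
  exact hlim.const_smul _

end Hamiltonian

/-! ### The error of the time-dependent multiproduct formula -/

section ErrorBound

open PowerSeries

variable {d : ℕ}

/-- The derivatives at `0` of the generator `-i H` on `[0, T]`. -/
noncomputable def generatorDeriv (H : ℝ → Op d) (T : ℝ) (p : ℕ) : Op d :=
  -Complex.I • iteratedDerivWithin p H (Icc 0 T) 0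

theorem norm_generatorDeriv_le {H : ℝ → Op d} {T L : ℝ} (hT : 0 ≤ T)
    (hb : ∀ p, ∀ t ∈ Icc 0 T, ‖iteratedDerivWithin p H (Icc 0 T) t‖ ≤ L ^ (p + 1)) (p : ℕ) :
    ‖generatorDeriv H T p‖ ≤ L ^ (p + 1) := by
  rw [generatorDeriv, norm_smul, norm_neg, Complex.norm_I, one_mul]
  exact hb p 0 ⟨le_rfl, hT⟩

variable [NeZero d]

theorem midpointSteps_eq_evalAt {H : ℝ → Op d} {T L : ℝ} (hT : 0 ≤ T)
    (hH : ContDiffOn ℝ (⊤ : ℕ∞) H (Icc 0 T))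
    (hb : ∀ p, ∀ t ∈ Icc 0 T, ‖iteratedDerivWithin p H (Icc 0 T) t‖ ≤ L ^ (p + 1)) (hL : 0 ≤ L)
    {k : ℕ} (hk : k ≠ 0) {x : ℝ} (hx : x ∈ Icc 0 T) :
    midpointSteps H k x 0 = evalAt (midpointSeries (generatorDeriv H T) k) x := by
  have hk' : (0 : ℝ) < k := mod_cast Nat.pos_of_ne_zero hk
  rw [(normLE_midpointSeries_and_evalAt (norm_generatorDeriv_le hT hb) hL hk hx.1).2,
    midpointSteps]
  congr 2
  refine List.map_congr_left fun r hr => ?_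
  have hr : (r : ℝ) + 1 ≤ k := mod_cast List.mem_range.1 hr
  have hc : ((r : ℝ) + 1 / 2) / k ∈ Icc (0 : ℝ) 1 :=
    ⟨by positivity, (div_le_one hk').2 (by linarith)⟩
  have h := evalAt_taylorSeries hT hH hb hL hc hx
  push_cast at h
  change evalAt (taylorSeries (generatorDeriv H T) _) x = _ at h
  rw [h, midpoint, smul_smul, smul_smul]
  have e₁ : 0 + (x - 0) * (r : ℝ) / k +
      (0 + (x - 0) * ((r + 1 : ℕ) : ℝ) / k - (0 + (x - 0) * (r : ℝ) / k)) / 2 =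
      ((r : ℝ) + 1 / 2) / k * x := by
    push_cast
    field_simp
    ring
  have e₂ : -Complex.I * ((0 + (x - 0) * ((r + 1 : ℕ) : ℝ) / k - (0 + (x - 0) * (r : ℝ) / k) : ℝ) :
      ℂ) = (x : ℂ) * (1 / k) * -Complex.I := by
    push_cast
    ring
  rw [e₁, e₂]

/-- The sum of the series solves the same linear initial value problem, whose right-hand side is
Lipschitz with constant L; uniqueness identifies the two. -/
theorem evolution_eq_evalAt {H : ℝ → Op d} {T L : ℝ} (hT : 0 ≤ T)
    (hH : ContDiffOn ℝ (⊤ : ℕ∞) H (Icc 0 T))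
    (hb : ∀ p, ∀ t ∈ Icc 0 T, ‖iteratedDerivWithin p H (Icc 0 T) t‖ ≤ L ^ (p + 1)) (hL : 0 < L)
    {U : ℝ → ℝ → Op d} (hU : IsTimeEvolution H (Icc 0 T) U) {x : ℝ} (hx : x ∈ Icc 0 T)
    (hLx : L * x ≤ 1) : U x 0 = evalAt (mk (evolutionCoeff (generatorDeriv H T))) x := by
  set g := generatorDeriv H T
  have hg : ∀ p, ‖g p‖ ≤ L ^ (p + 1) := norm_generatorDeriv_le hT hb
  set V : ℝ → Op d := evalAt (mk (evolutionCoeff g)) with hV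
  obtain ⟨hU0, hUd⟩ := hU 0 ⟨le_rfl, hT⟩
  have hLt : ∀ t ∈ Icc 0 x, L * t ≤ 1 := fun t ht =>
    (mul_le_mul_of_nonneg_left ht.2 hL.le).trans hLx
  have hVd : ∀ t ∈ Icc 0 x, HasDerivAt V (-Complex.I • (H t * V t)) t := by
    intro t ht
    -- The radius 3/(2L) lies strictly between 1/L, which bounds t, and 2/L, where the geometric
    -- majorant stops converging.
    have hR : |t| < 3 / 2 / L := by
      rw [abs_of_nonneg ht.1, lt_div_iff₀ hL, mul_comm]
      linarith [hLt t ht]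
    have h := hasDerivAt_evalAt (P := mk (evolutionCoeff g)) (B := 2 ^ 15) (ρ := L / 2)
      (fun n => by rw [coeff_mk]; exact norm_evolutionCoeff_le_geometric hg hL.le n)
      (by positivity) (by field_simp; norm_num) hR
    have e : (mk fun n => ((n : ℂ) + 1) • coeff (n + 1) (mk (evolutionCoeff g))) =
        taylorSeries g 1 * mk (evolutionCoeff g) := by
      ext n : 1
      rw [coeff_mk, coeff_mk, evolutionCoeff_succ]
    have hT1 := evalAt_taylorSeries hT hH hb hL.le (c := 1) ⟨zero_le_one, le_rfl⟩
      ⟨ht.1, ht.2.trans hx.2⟩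
    rw [Complex.ofReal_one, one_mul] at hT1
    rw [e, evalAt_mul ht.1 (NormLE.taylorSeries hg hL.le (by simp) ht.1)
      (normLE_evolutionCoeff hg hL.le ht.1 (hLt t ht))] at h
    change evalAt (taylorSeries g 1) t = _ at hT1
    rwa [hT1, smul_mul_assoc] at h
  have hV0 : V 0 = 1 := by
    rw [hV, evalAt, tsum_eq_single 0]
    · simp [evolutionCoeff]
    · intro n hn
      rw [Complex.ofReal_zero, zero_pow hn, zero_smul]
  have hsub : ∀ t ∈ Ico 0 x, t ∈ Icc 0 T := fun t ht => ⟨ht.1, ht.2.le.trans hx.2⟩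
  have huniq := ODE_solution_unique_of_mem_Icc_right (a := 0) (b := x)
    (v := fun t z => -Complex.I • (H t * z)) (s := fun _ => univ) (K := L.toNNReal)
    (f := fun t => U t 0) (g := V) ?_ ?_ ?_ (fun _ _ => mem_univ _) ?_ ?_ (fun _ _ => mem_univ _)
    (by rw [hU0, hV0])
  · exact huniq ⟨hx.1, le_rfl⟩
  · intro t ht
    refine LipschitzOnWith.of_dist_le_mul fun y _ z _ => ?_
    rw [dist_eq_norm, dist_eq_norm, ← smul_sub, ← mul_sub, norm_smul, norm_neg, Complex.norm_I,
      one_mul, Real.coe_toNNReal L hL.le]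
    refine (norm_mul_le _ _).trans (mul_le_mul_of_nonneg_right ?_ (norm_nonneg _))
    simpa using hb 0 t (hsub t ht)
  · exact fun t ht => ((hUd t ⟨ht.1, ht.2.trans hx.2⟩).continuousWithinAt).mono
      (Icc_subset_Icc_right hx.2)
  · intro t ht
    refine (hUd t (hsub t ht)).mono_of_mem_nhdsWithin ?_
    exact mem_of_superset (Icc_mem_nhdsGE (ht.2.trans_le hx.2)) (Icc_subset_Icc_left ht.1)
  · exact fun t ht => (hVd t ht).continuousAt.continuousWithinAt
  · exact fun t ht => (hVd t ⟨ht.1, ht.2.le⟩).hasDerivWithinAt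

/-- U*U has zero derivative because H is Hermitian, so it stays equal to 1; the C*-identity gives
the norm. -/
theorem norm_evolution {H : ℝ → Op d} {T : ℝ} (hT : 0 ≤ T)
    (hherm : ∀ t ∈ Icc 0 T, (H t).IsHermitian) {U : ℝ → ℝ → Op d}
    (hU : IsTimeEvolution H (Icc 0 T) U) {x : ℝ} (hx : x ∈ Icc 0 T) : ‖U x 0‖ = 1 := by
  obtain ⟨hU0, hUd⟩ := hU 0 ⟨le_rfl, hT⟩
  have hd : ∀ t ∈ Icc 0 T, HasDerivWithinAt (fun t => star (U t 0) * U t 0) 0 (Icc 0 T) t := by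
    intro t ht
    have h := (hUd t ht).star.fun_mul (hUd t ht)
    have hs : star (H t) = H t := hherm t ht
    refine h.congr_deriv ?_
    rw [star_smul, star_mul, hs, star_neg, Complex.star_def, Complex.conj_I, neg_neg,
      smul_mul_assoc, mul_smul_comm, mul_assoc, neg_smul, add_neg_cancel]
  have hconst := constant_of_derivWithin_zero (fun t ht => (hd t ht).differentiableWithinAt)
    (fun t ht => by
      have ht' : t ∈ Icc 0 T := Ico_subset_Icc_self ht
      exact (hd t ht').derivWithin (uniqueDiffOn_Icc (ht.1.trans_lt ht.2) t ht')) x hx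
  rw [hU0, star_one, one_mul] at hconst
  have hn := CStarRing.norm_star_mul_self (x := U x 0)
  rw [hconst, norm_one] at hn
  nlinarith [norm_nonneg (U x 0)]

theorem norm_exp_smul_isHermitian {A : Op d} (hA : A.IsHermitian) (c : ℝ) :
    ‖NormedSpace.exp ((-Complex.I * (c : ℂ)) • A)‖ = 1 := by
  let : NormedAlgebra ℚ (Op d) := NormedAlgebra.restrictScalars ℚ ℂ (Op d)
  refine CStarRing.norm_of_mem_unitary (NormedSpace.exp_mem_unitary_of_mem_skewAdjoint ?_)
  have hs : star A = A := hA
  rw [skewAdjoint.mem_iff, star_smul, hs, star_mul', star_neg, Complex.star_def, Complex.conj_I,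
    Complex.conj_ofReal, ← neg_smul]
  congr 1
  ring

theorem norm_midpointSteps_le {H : ℝ → Op d} {T : ℝ} (hherm : ∀ t ∈ Icc 0 T, (H t).IsHermitian)
    {k : ℕ} {x : ℝ} (hx : x ∈ Icc 0 T) : ‖midpointSteps H k x 0‖ ≤ 1 := by
  have hl : ∀ l : List (Op d), (∀ A ∈ l, ‖A‖ ≤ 1) → ‖l.prod‖ ≤ 1 := by
    intro l hl
    induction l with
    | nil => simp
    | cons A l ih =>
      rw [List.prod_cons]
      exact (norm_mul_le _ _).trans (mul_le_one₀ (hl A (by simp)) (norm_nonneg _)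
        (ih fun B hB => hl B (by simp [hB])))
  refine hl _ fun A hA => ?_
  rw [List.mem_reverse, List.mem_map] at hA
  obtain ⟨r, hr, rfl⟩ := hA
  have hr : (r : ℝ) + 1 ≤ k := mod_cast List.mem_range.1 hr
  have hk : (0 : ℝ) < k := by linarith [Nat.cast_nonneg (α := ℝ) r]
  refine (norm_exp_smul_isHermitian (hherm _ ?_) _).le
  have e : 0 + (x - 0) * (r : ℝ) / k +
      (0 + (x - 0) * ((r + 1 : ℕ) : ℝ) / k - (0 + (x - 0) * (r : ℝ) / k)) / 2 =
      ((r : ℝ) + 1 / 2) / k * x := by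
    push_cast
    field_simp
    ring
  rw [e]
  have hc : ((r : ℝ) + 1 / 2) / k ≤ 1 := (div_le_one hk).2 (by linarith)
  exact ⟨mul_nonneg (by positivity) hx.1, (mul_le_of_le_one_left hx.1 hc).trans hx.2⟩

theorem norm_timeDependentMPF_sub_le {M : ℕ} {a : Fin M → ℝ} {k : Fin M → ℕ} (h : IsMPFData a k)
    {H : ℝ → Op d} {T L : ℝ} (hT : 0 ≤ T) (hherm : ∀ t ∈ Icc 0 T, (H t).IsHermitian)
    (hH : ContDiffOn ℝ (⊤ : ℕ∞) H (Icc 0 T))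
    (hb : ∀ p, ∀ t ∈ Icc 0 T, ‖iteratedDerivWithin p H (Icc 0 T) t‖ ≤ L ^ (p + 1)) (hL : 0 < L)
    {U : ℝ → ℝ → Op d} (hU : IsTimeEvolution H (Icc 0 T) U) {x : ℝ} (hx : x ∈ Icc 0 T) :
    ‖timeDependentMPF a k H x 0 - U x 0‖ ≤
      (Real.exp (Real.exp 1) + 2 ^ 16) * ((∑ j, |a j|) * (L * x) ^ (2 * M + 1)) := by
  have ha := h.one_le_sum_abs
  set g := generatorDeriv H T
  have hg : ∀ p, ‖g p‖ ≤ L ^ (p + 1) := norm_generatorDeriv_le hT hb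
  have hk : ∀ j, k j ≠ 0 := fun j => (h.1 j).ne'
  have hnorm : ∀ j, ‖(a j : ℂ)‖ = |a j| := fun j => by rw [Complex.norm_real, Real.norm_eq_abs]
  rcases le_or_gt (L * x) 1 with hLx | hLx
  · have hm : ∀ j, ∀ y, 0 ≤ y → NormLE ((a j : ℂ) • midpointSeries g (k j)) y
        (‖(a j : ℂ)‖ * Real.exp (y * (L * Real.exp (L * y)))) := fun j y hy =>
      (normLE_midpointSeries_and_evalAt hg hL.le (hk j) hy).1.smul _
    have hS := fun y hy => NormLE.sum (s := Finset.univ) hy fun j _ => hm j y hy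
    have hu := fun (y : ℝ) (hy : 0 ≤ y) (hLy : L * y ≤ 1) =>
      (normLE_evolutionCoeff hg hL.le hy hLy).smul (-1)
    set P : (Op d)⟦X⟧ := ∑ j, (a j : ℂ) • midpointSeries g (k j) +
      (-1 : ℂ) • mk (evolutionCoeff g) with hP
    have hev : timeDependentMPF a k H x 0 - U x 0 = evalAt P x := by
      rw [hP, evalAt_add hx.1 (hS x hx.1) (hu x hx.1 hLx), evalAt_sum hx.1 fun j _ => hm j x hx.1,
        evalAt_smul hx.1 (normLE_evolutionCoeff hg hL.le hx.1 hLx), neg_one_smul,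
        ← sub_eq_add_neg, evolution_eq_evalAt hT hH hb hL hU hx hLx, timeDependentMPF]
      congr 1
      refine Finset.sum_congr rfl fun j _ => ?_
      rw [evalAt_smul hx.1 (normLE_midpointSeries_and_evalAt hg hL.le (hk j) hx.1).1,
        midpointSteps_eq_evalAt hT hH hb hL.le (hk j) hx]
    -- At radius 1/L the gain (x / y)^{2M+1} is (Lx)^{2M+1}, and the midpoint bound becomes e^e.
    have hy : (0 : ℝ) < L⁻¹ := inv_pos.2 hL
    have hLy : L * L⁻¹ = 1 := mul_inv_cancel₀ hL.ne'
    have hPy := (hS L⁻¹ hy.le).add hy.le (hu L⁻¹ hy.le hLy.le)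
    have hzero : ∀ n < 2 * M + 1, coeff n P = 0 := fun n hn => by
      rw [hP, map_add, coeff_const_smul, coeff_mk, coeff_sum_midpointSeries hk g
        fun m hm => h.coeff_mpfSeries _ _ (hm.trans (Nat.le_of_lt_succ hn)), neg_one_smul,
        add_neg_cancel]
    have hxy : x ≤ L⁻¹ := by rwa [← one_div, le_div_iff₀ hL, mul_comm]
    have hfin := hPy.norm_evalAt_le_of_coeff_eq_zero hx.1 hy hxy hzero
    rw [hev]
    refine hfin.trans ?_
    rw [← Finset.sum_mul, hLy, ← mul_assoc L⁻¹, inv_mul_cancel₀ hL.ne', one_mul, norm_neg, norm_one,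
      one_mul, div_inv_eq_mul, mul_comm x L]
    simp only [hnorm]
    have hp : 0 ≤ (L * x) ^ (2 * M + 1) := pow_nonneg (mul_nonneg hL.le hx.1) _
    calc (L * x) ^ (2 * M + 1) * ((∑ j, |a j|) * Real.exp (Real.exp 1) + 2 ^ 16)
        ≤ (L * x) ^ (2 * M + 1) *
          ((∑ j, |a j|) * Real.exp (Real.exp 1) + (∑ j, |a j|) * 2 ^ 16) := by
          gcongr
          linarith
      _ = _ := by ring
  -- For Lx > 1 the triangle inequality gives ‖a‖₁ + 1 ≤ 2‖a‖₁, and (Lx)^{2M+1} ≥ 1.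
  · have h₁ : ‖timeDependentMPF a k H x 0‖ ≤ ∑ j, |a j| := by
      rw [timeDependentMPF]
      refine (norm_sum_le _ _).trans (Finset.sum_le_sum fun j _ => ?_)
      rw [norm_smul, hnorm]
      exact mul_le_of_le_one_right (abs_nonneg _) (norm_midpointSteps_le hherm hx)
    have h₂ := (norm_sub_le (timeDependentMPF a k H x 0) (U x 0)).trans
      (add_le_add h₁ (norm_evolution hT hherm hU hx).le)
    have h₃ : 1 ≤ (L * x) ^ (2 * M + 1) := one_le_pow₀ hLx.le
    have h₄ : (2 : ℝ) ≤ Real.exp (Real.exp 1) + 2 ^ 16 := by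
      have := Real.exp_pos (Real.exp 1)
      linarith
    calc _ ≤ 2 * ((∑ j, |a j|) * 1) := by linarith
      _ ≤ _ := by gcongr

end ErrorBound

/-! ### From Λ to derivative bounds, and the main theorem. -/

theorem norm_iteratedDerivWithin_le_Lam {d : ℕ} {H : ℝ → Op d} {I : Set ℝ}
    (hb : BddAbove (derivScales H I)) (p : ℕ) {t : ℝ} (ht : t ∈ I) :
    ‖iteratedDerivWithin p H I t‖ ≤ Lam H I ^ (p + 1) := by
  have h : ‖iteratedDerivWithin p H I t‖ ^ (1 / ((p : ℝ) + 1)) ≤ Lam H I :=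
    le_csSup hb ⟨t, ht, p, rfl⟩
  have h' := pow_le_pow_left₀ (Real.rpow_nonneg (norm_nonneg _) _) h (p + 1)
  rwa [← Real.rpow_natCast, ← Real.rpow_mul (norm_nonneg _), Nat.cast_succ,
    one_div_mul_cancel (Nat.cast_add_one_ne_zero p), Real.rpow_one] at h'

end MPF

theorem mainTheorem3 :
    ∃ C : ℝ, 0 < C ∧
      ∀ (M : ℕ) (a : Fin M → ℝ) (k : Fin M → ℕ), MPF.IsMPFData a k →
      ∀ (d : ℕ) (H : ℝ → MPF.Op d) (n_p q : ℕ),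
        (∀ t ∈ Icc (0 : ℝ) (2 ^ q), (H t).IsHermitian) →
        ContDiffOn ℝ (⊤ : ℕ∞) H (Icc 0 (2 ^ q)) →
        MPF.ClockPeriodic H n_p q →
        BddAbove (MPF.derivScales H (Icc 0 (2 ^ q))) →
      ∀ U : ℝ → ℝ → MPF.Op d, MPF.IsTimeEvolution H (Icc 0 (2 ^ q)) U →
      ∀ s : ℝ, 0 ≤ s → s / 2 ^ n_p ≤ 2 ^ q →
        ‖MPF.timeDependentMPF a k H (s / 2 ^ n_p) 0 - U (s / 2 ^ n_p) 0‖ ≤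
          C * ((∑ j, |a j|) * (MPF.Lam H (Icc 0 (2 ^ q)) * (s / 2 ^ n_p)) ^ (2 * M + 1)) := by
  refine ⟨Real.exp (Real.exp 1) + 2 ^ 16, by positivity, ?_⟩
  intro M a k hak d H n_p q hherm hH _ hbdd U hU s hs hsq
  set T : ℝ := 2 ^ q with hTdef
  have hT : 0 ≤ T := by positivity
  set x := s / 2 ^ n_p with hxdef
  have hx : x ∈ Icc 0 T := ⟨by positivity, hsq⟩
  have hb := fun p t ht => MPF.norm_iteratedDerivWithin_le_Lam hbdd p (t := t) ht
  set Λ := MPF.Lam H (Icc 0 T)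
  have hΛ : 0 ≤ Λ := by simpa using (norm_nonneg _).trans (hb 0 0 ⟨le_rfl, hT⟩)
  -- For d = 0 the identity has norm 0, so the estimates relying on ‖1‖ = 1 need d > 0.
  rcases Nat.eq_zero_or_pos d with rfl | hd
  · rw [Subsingleton.elim (MPF.timeDependentMPF a k H x 0 - U x 0) 0, norm_zero]
    have := Finset.sum_nonneg fun j (_ : j ∈ Finset.univ) => abs_nonneg (a j)
    have := hx.1
    positivity
  have : NeZero d := ⟨hd.ne'⟩
  -- Λ may be 0, whereas the radius 1/L needs L > 0; the bound is proved for L > Λ and passes to the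
  -- limit by continuity.
  have hbound : ∀ L : ℝ, Λ < L → ‖MPF.timeDependentMPF a k H x 0 - U x 0‖ ≤
      (Real.exp (Real.exp 1) + 2 ^ 16) * ((∑ j, |a j|) * (L * x) ^ (2 * M + 1)) := fun L hL =>
    MPF.norm_timeDependentMPF_sub_le hak hT hherm hH
      (fun p t ht => (hb p t ht).trans (pow_le_pow_left₀ hΛ hL.le _)) (hΛ.trans_lt hL) hU hx
  have hcont : Continuous fun L : ℝ =>
      (Real.exp (Real.exp 1) + 2 ^ 16) * ((∑ j, |a j|) * (L * x) ^ (2 * M + 1)) := by fun_prop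
  refine ge_of_tendsto ((hcont.tendsto Λ).mono_left (nhdsWithin_le_nhds (s := Ioi Λ))) ?_
  filter_upwards [self_mem_nhdsWithin] with L hL using hbound L hL
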